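/- Let $a,p\ge 1$, $c\ge 0$ be fixed integers. For each total sample size $N$ let $n_1,\dots,n_a$ be group sizes (depending on $N$) with $\sum_i n_i=N$, and observe, for $1\le i\le a$ and $1\le j\le n_i$, $$\mathbf Y_{ij}=\boldsymbol\mu_i+\sum_{w=1}^c z_{ij}^{(w)}\boldsymbol\nu^{(w)}+\boldsymbol\epsilon_{ij}\in\mathbb R^p ,$$ where $\boldsymbol\mu_i,\boldsymbol\nu^{(w)}\in\mathbb R^p$ are fixed, $\boldsymbol\mu=(\boldsymbol\mu_1',\dots,\boldsymbol\mu_a')'$, and the fixed covariates $\mathbf z_{ij}=(z_{ij}^{(1)},\dots,z_{ij}^{(c)})'$ and the errors $\boldsymbol\epsilon_{ij}=(\epsilon_{ij1},\dots,\epsilon_{ijp})'$ form, for each group $i$, sequences indexed by $j$ that do not depend on $N$. Let $\mathbf X=(\bigoplus_{i}\mathbf 1_{n_i},\mathbf Z)$, where $\mathbf Z$ has the rows $\mathbf z_{ij}'$, and $\tilde{\mathbf X}=\mathbf X\otimes\mathbf I_p$. Assume, all limits being for $N\to\infty$: (M1) the $\boldsymbol\epsilon_{ij}$ are independent with $E[\boldsymbol\epsilon_{ij}]=\mathbf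 0$, $Cov[\boldsymbol\epsilon_{ij}]=\boldsymbol\Sigma_i$ and $E[\epsilon_{ijk}^4]\le C_1<\infty$ for all $i,j,k$; (M2)* $\boldsymbol\Sigma_i\ge 0$, and its diagonal entries satisfy $\sigma_{ik}^2>0$, for all $i,k$; (M3) $N/n_i\to\kappa_i>0$ for all $i$; (M4) for all sufficiently large $N$ the columns of $\mathbf X$ are linearly independent, and the limit $\boldsymbol\Xi=\lim N^{-1}\mathbf X'\mathbf X$ (which exists by (M3), (M5), (M6)) is nonsingular; (M5) $n_i^{-1}\sum_{j\le n_i}z_{ij}^{(w)}\to c_i^{(w)}\in\mathbb R$ for all $i,w$; (M6) $n_i^{-1}\sum_{j\le n_i}\mathbf z_{ij}\mathbf z_{ij}'\to\boldsymbol\Xi_i\in\mathbb R^{c\times c}$ for all $i$. Let $\mathbf H$ be a real matrix with $ap$ columns (for instance a contrast matrix), let $\mathbf T=\mathbf H'(\mathbf H\mathbf H')^+\mathbf H$, where $^+$ is the Moore–Penrose inverse, and suppose that $H_0:\mathbf T\boldsymbol\mu=\mathbf 0$ holds. Let $(\hat{\boldsymbol\mu}',\hat{\boldsymbol\nu}')'=(\tilde{\mathbf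 X}'\tilde{\mathbf X})^{-1}\tilde{\mathbf X}'\mathbf Y$ be the ordinary least squares estimator, $u_{ijk}=Y_{ijk}-\hat\mu_{ik}-\sum_w z_{ij}^{(w)}\hat\nu_k^{(w)}$ the residuals, $\hat\sigma_{ik}^2=(n_i-c-1)^{-1}\sum_{j\le n_i}u_{ijk}^2$, $\hat{\mathbf D}=diag(n_1^{-1}\hat\sigma_{11}^2,\dots,n_1^{-1}\hat\sigma_{1p}^2,\dots,n_a^{-1}\hat\sigma_{ap}^2)$, and $$A(\mathbf T)=\hat{\boldsymbol\mu}'\mathbf T'(\mathbf T\hat{\mathbf D}\mathbf T)^+\mathbf T\hat{\boldsymbol\mu}.$$ Then the limits $\boldsymbol\Xi=\lim N^{-1}\mathbf X'\mathbf X$, $\boldsymbol\Psi=\lim N^{-1}\tilde{\mathbf X}'Cov(\boldsymbol\epsilon)\tilde{\mathbf X}$ and $$\boldsymbol\Lambda=\lim\,(N^{-1}\tilde{\mathbf X}'\tilde{\mathbf X})^{-1}(N^{-1}\tilde{\mathbf X}'Cov(\boldsymbol\epsilon)\tilde{\mathbf X})(N^{-1}\tilde{\mathbf X}'\tilde{\mathbf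 X})^{-1}=(\boldsymbol\Xi^{-1}\otimes\mathbf I_p)\boldsymbol\Psi(\boldsymbol\Xi^{-1}\otimes\mathbf I_p)$$ exist, where $Cov(\boldsymbol\epsilon)=\bigoplus_i(\mathbf I_{n_i}\otimes\boldsymbol\Sigma_i)$, and as $N\to\infty$ the statistic $A(\mathbf T)$ converges in distribution to $$U=\sum_{i=1}^a\sum_{k=1}^p\lambda_{ik}U_{ik},$$ where the $U_{ik}$ are independent and $\chi_1^2$-distributed and the $\lambda_{ik}$ are the eigenvalues, all real and counted with multiplicity, of $\mathbf T(\mathbf T\mathbf D\mathbf T)^+\mathbf T\boldsymbol\Lambda_{11}$. Here $\mathbf D=\bigoplus_{i}\bigoplus_{k}\kappa_i\sigma_{ik}^2$, and $\boldsymbol\Lambda_{11}$ is the upper-left $ap\times ap$ block of $\boldsymbol\Lambda$. -/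

import Mathlib

open MeasureTheory ProbabilityTheory Filter Topology Matrix
open scoped Kronecker

namespace Mancova

section MoorePenrose

variable {m n : Type*} [Fintype m] [Fintype n]

/-- The four Penrose equations: `B` is the Moore-Penrose inverse of the real matrix `A`. -/
structure IsMoorePenrose (A : Matrix m n ℝ) (B : Matrix n m ℝ) : Prop where
  mul_mul_self : A * B * A = A
  self_mul_mul : B * A * B = B
  symm_left : (A * B)ᵀ = A * B
  symm_right : (B * A)ᵀ = B * A

theorem IsMoorePenrose.unique {A : Matrix m n ℝ} {B C : Matrix n m ℝ}
    (hB : IsMoorePenrose A B) (hC : IsMoorePenrose A C) : B = C := by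
  have h1 : A * B = A * C := by
    calc A * B = (A * B)ᵀ := hB.symm_left.symm
      _ = (A * C * A * B)ᵀ := by rw [hC.mul_mul_self]
      _ = (A * B)ᵀ * (A * C)ᵀ := by rw [← transpose_mul, Matrix.mul_assoc (A * C)]
      _ = A * B * A * C := by rw [hB.symm_left, hC.symm_left, ← Matrix.mul_assoc]
      _ = A * C := by rw [hB.mul_mul_self]
  have h2 : B * A = C * A := by
    calc B * A = (B * A)ᵀ := hB.symm_right.symm
      _ = (B * (A * C * A))ᵀ := by rw [hC.mul_mul_self]
      _ = (C * A)ᵀ * (B * A)ᵀ := by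
          rw [← transpose_mul]; simp only [Matrix.mul_assoc]
      _ = C * (A * B * A) := by
          rw [hB.symm_right, hC.symm_right]; simp only [Matrix.mul_assoc]
      _ = C * A := by rw [hB.mul_mul_self]
  calc B = B * A * B := hB.self_mul_mul.symm
    _ = C * (A * B) := by rw [h2, Matrix.mul_assoc]
    _ = C * A * C := by rw [h1, Matrix.mul_assoc]
    _ = C := hC.self_mul_mul

theorem exists_isMoorePenrose (A : Matrix m n ℝ) : ∃ B, IsMoorePenrose A B := by
  classical
  obtain ⟨P, hP1, hP2, hP3, hP4⟩ : ∃ P : Matrix n n ℝ, (Aᵀ * A) * P * (Aᵀ * A) = Aᵀ * A ∧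
      P * (Aᵀ * A) * P = P ∧ Pᵀ = P ∧ (P * (Aᵀ * A))ᵀ = P * (Aᵀ * A) := by
    have hG : (Aᵀ * A).IsHermitian := by
      simp [Matrix.IsHermitian, conjTranspose_eq_transpose_of_trivial]
    obtain ⟨U, d, hU, hUd⟩ : ∃ (U : Matrix n n ℝ) (d : n → ℝ), Uᵀ * U = 1 ∧
        Aᵀ * A = U * diagonal d * Uᵀ := by
      refine ⟨hG.eigenvectorUnitary, hG.eigenvalues, ?_, ?_⟩
      · have := Unitary.coe_star_mul_self hG.eigenvectorUnitary
        simpa [star_eq_conjTranspose, conjTranspose_eq_transpose_of_trivial] using this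
      · have := hG.spectral_theorem
        simpa [Unitary.conjStarAlgAut_apply, star_eq_conjTranspose,
          conjTranspose_eq_transpose_of_trivial, Function.comp_def] using this
    have key : ∀ e f : n → ℝ, (U * diagonal e * Uᵀ) * (U * diagonal f * Uᵀ)
        = U * diagonal (fun i => e i * f i) * Uᵀ := by
      intro e f
      calc (U * diagonal e * Uᵀ) * (U * diagonal f * Uᵀ)
          = U * diagonal e * (Uᵀ * U) * diagonal f * Uᵀ := by simp only [Matrix.mul_assoc]
        _ = _ := by
          rw [hU, Matrix.mul_one, Matrix.mul_assoc U, diagonal_mul_diagonal]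
    have ksymm : ∀ e : n → ℝ, (U * diagonal e * Uᵀ)ᵀ = U * diagonal e * Uᵀ := by
      intro e
      simp [transpose_mul, Matrix.mul_assoc]
    refine ⟨U * diagonal (fun i => (d i)⁻¹) * Uᵀ, ?_, ?_, ksymm _, ?_⟩
    · rw [hUd, key, key]
      simp [mul_inv_mul_cancel]
    · rw [hUd, key, key]
      congr 3
      funext i
      by_cases h : d i = 0 <;> simp [h]
    · rw [hUd, key, ksymm]
  have hA : A * (P * (Aᵀ * A)) = A := by
    have h0 : (A * (P * (Aᵀ * A)) - A)ᵀ * (A * (P * (Aᵀ * A)) - A) = 0 := by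
      have : Aᵀ * (A * (P * (Aᵀ * A)) - A) = 0 := by
        rw [Matrix.mul_sub, sub_eq_zero, ← Matrix.mul_assoc, ← Matrix.mul_assoc]
        exact hP1
      rw [transpose_sub, Matrix.sub_mul, transpose_mul A, Matrix.mul_assoc, this]
      simp
    have h1 := conjTranspose_mul_self_eq_zero (A := A * (P * (Aᵀ * A)) - A)
    rw [conjTranspose_eq_transpose_of_trivial] at h1
    exact sub_eq_zero.mp (h1.mp h0)
  refine ⟨P * Aᵀ, ?_, ?_, ?_, ?_⟩
  · simpa only [Matrix.mul_assoc] using hA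
  · calc P * Aᵀ * A * (P * Aᵀ) = P * (Aᵀ * A) * P * Aᵀ := by simp only [Matrix.mul_assoc]
      _ = _ := by rw [hP2]
  · simp only [transpose_mul, transpose_transpose, hP3, Matrix.mul_assoc]
  · rw [Matrix.mul_assoc, hP4]

/-- The Moore-Penrose inverse `A⁺` of a real matrix. -/
noncomputable def pinv (A : Matrix m n ℝ) : Matrix n m ℝ :=
  (exists_isMoorePenrose A).choose

theorem pinv_spec (A : Matrix m n ℝ) : IsMoorePenrose A (pinv A) :=
  (exists_isMoorePenrose A).choose_spec

end MoorePenrose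

/-- The chi-squared distribution with one degree of freedom, the law of the square of a
standard normal variable. -/
noncomputable def chiSqOne : Measure ℝ := (gaussianReal 0 1).map (fun x => x ^ 2)

/-- The projector form `T = H' (H H')⁺ H` of a hypothesis matrix `H`. -/
noncomputable def hypothesisProjector {r d : Type*} [Fintype r] [Fintype d]
    (H : Matrix r d ℝ) : Matrix d d ℝ :=
  Hᵀ * pinv (H * Hᵀ) * H

section Model

variable {a p c : ℕ}

/-- Subjects `(i, j)`: group `i`, number `j` within the group, with group sizes `n`. -/
abbrev Subj (n : Fin a → ℕ) : Type := (i : Fin a) × Fin (n i)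

/-- The design matrix `X = (⊕ᵢ 1_{nᵢ}, Z)`. -/
def designMatrix (n : Fin a → ℕ) (z : Fin a → ℕ → Fin c → ℝ) :
    Matrix (Subj n) (Fin a ⊕ Fin c) ℝ :=
  Matrix.of fun s q =>
    Sum.elim (fun i => if s.1 = i then (1 : ℝ) else 0) (fun w => z s.1 s.2 w) q

/-- The multivariate design matrix `X̃ = X ⊗ I_p = (⊕ᵢ (1_{nᵢ} ⊗ I_p), Z ⊗ I_p)`. -/
def bigDesignMatrix (p : ℕ) (n : Fin a → ℕ) (z : Fin a → ℕ → Fin c → ℝ) :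
    Matrix (Subj n × Fin p) ((Fin a ⊕ Fin c) × Fin p) ℝ :=
  designMatrix n z ⊗ₖ (1 : Matrix (Fin p) (Fin p) ℝ)

/-- `Cov(ε) = ⊕ᵢ (I_{nᵢ} ⊗ Σᵢ)`. -/
def errorCov (n : Fin a → ℕ) (S : Fin a → Matrix (Fin p) (Fin p) ℝ) :
    Matrix (Subj n × Fin p) (Subj n × Fin p) ℝ :=
  Matrix.of fun s t => if s.1 = t.1 then S s.1.1 s.2 t.2 else 0

/-- The stacked vector of the outcomes `y i j k` of all subjects in the sample. -/
def outcomeVector (n : Fin a → ℕ) (y : Fin a → ℕ → Fin p → ℝ) : Subj n × Fin p → ℝ :=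
  fun s => y s.1.1 s.1.2 s.2

/-- The ordinary least squares estimator `β̂ = (μ̂', ν̂')' = (X̃'X̃)⁻¹ X̃' Y`. -/
noncomputable def olsEstimator (n : Fin a → ℕ) (z : Fin a → ℕ → Fin c → ℝ)
    (y : Fin a → ℕ → Fin p → ℝ) : (Fin a ⊕ Fin c) × Fin p → ℝ :=
  (((bigDesignMatrix p n z)ᵀ * bigDesignMatrix p n z)⁻¹ * (bigDesignMatrix p n z)ᵀ) *ᵥ
    outcomeVector n y

/-- The estimator `μ̂` of the adjusted means. -/
noncomputable def muHat (n : Fin a → ℕ) (z : Fin a → ℕ → Fin c → ℝ)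
    (y : Fin a → ℕ → Fin p → ℝ) : Fin a × Fin p → ℝ :=
  fun q => olsEstimator n z y (Sum.inl q.1, q.2)

/-- The estimator `ν̂` of the regression coefficients. -/
noncomputable def nuHat (n : Fin a → ℕ) (z : Fin a → ℕ → Fin c → ℝ)
    (y : Fin a → ℕ → Fin p → ℝ) : Fin c × Fin p → ℝ :=
  fun q => olsEstimator n z y (Sum.inr q.1, q.2)

/-- The residual `u_{ijk}`. -/
noncomputable def residual (n : Fin a → ℕ) (z : Fin a → ℕ → Fin c → ℝ)
    (y : Fin a → ℕ → Fin p → ℝ) (i : Fin a) (j : ℕ) (k : Fin p) : ℝ :=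
  y i j k - muHat n z y (i, k) - ∑ w, z i j w * nuHat n z y (w, k)

/-- The groupwise residual variance `σ̂²_{ik}`. -/
noncomputable def sigmaHatSq (n : Fin a → ℕ) (z : Fin a → ℕ → Fin c → ℝ)
    (y : Fin a → ℕ → Fin p → ℝ) (i : Fin a) (k : Fin p) : ℝ :=
  1 / ((n i : ℝ) - c - 1) * ∑ j : Fin (n i), residual n z y i j k ^ 2

/-- `D̂ = diag(σ̂²_{ik} / nᵢ)`. -/
noncomputable def DHat (n : Fin a → ℕ) (z : Fin a → ℕ → Fin c → ℝ)
    (y : Fin a → ℕ → Fin p → ℝ) : Matrix (Fin a × Fin p) (Fin a × Fin p) ℝ :=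
  Matrix.diagonal fun q => 1 / (n q.1 : ℝ) * sigmaHatSq n z y q.1 q.2

/-- The MANCATS statistic `A(T) = μ̂' T' (T D̂ T)⁺ T μ̂`. -/
noncomputable def mancats (n : Fin a → ℕ) (z : Fin a → ℕ → Fin c → ℝ)
    (T : Matrix (Fin a × Fin p) (Fin a × Fin p) ℝ) (y : Fin a → ℕ → Fin p → ℝ) : ℝ :=
  muHat n z y ⬝ᵥ ((Tᵀ * pinv (T * DHat n z y * T) * T) *ᵥ muHat n z y)

/-- `D = diag(κᵢ σ²_{ik})`, where `σ²_{ik}` is the `k`-th diagonal entry of `Σᵢ`. -/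
def limitD (κ : Fin a → ℝ) (S : Fin a → Matrix (Fin p) (Fin p) ℝ) :
    Matrix (Fin a × Fin p) (Fin a × Fin p) ℝ :=
  Matrix.diagonal fun q => κ q.1 * S q.1 q.2 q.2

/-- `N⁻¹ X'X`. -/
noncomputable def scaledGram (N : ℕ) (n : Fin a → ℕ) (z : Fin a → ℕ → Fin c → ℝ) :
    Matrix (Fin a ⊕ Fin c) (Fin a ⊕ Fin c) ℝ :=
  (N : ℝ)⁻¹ • ((designMatrix n z)ᵀ * designMatrix n z)

/-- `N⁻¹ X̃'X̃`. -/
noncomputable def bigScaledGram (p N : ℕ) (n : Fin a → ℕ) (z : Fin a → ℕ → Fin c → ℝ) :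
    Matrix ((Fin a ⊕ Fin c) × Fin p) ((Fin a ⊕ Fin c) × Fin p) ℝ :=
  (N : ℝ)⁻¹ • ((bigDesignMatrix p n z)ᵀ * bigDesignMatrix p n z)

/-- `N⁻¹ X̃' Cov(ε) X̃`. -/
noncomputable def scaledMiddle (N : ℕ) (n : Fin a → ℕ) (z : Fin a → ℕ → Fin c → ℝ)
    (S : Fin a → Matrix (Fin p) (Fin p) ℝ) :
    Matrix ((Fin a ⊕ Fin c) × Fin p) ((Fin a ⊕ Fin c) × Fin p) ℝ :=
  (N : ℝ)⁻¹ • ((bigDesignMatrix p n z)ᵀ * errorCov n S * bigDesignMatrix p n z)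

/-- The upper-left `ap × ap` block of an `(a+c)p × (a+c)p` matrix. -/
def upperLeft (L : Matrix ((Fin a ⊕ Fin c) × Fin p) ((Fin a ⊕ Fin c) × Fin p) ℝ) :
    Matrix (Fin a × Fin p) (Fin a × Fin p) ℝ :=
  L.submatrix (fun q => (Sum.inl q.1, q.2)) (fun q => (Sum.inl q.1, q.2))

end Model

end Mancova

namespace Mancova

/-! ### Lyapunov's central limit theorem via characteristic functions. -/

section CharacteristicFunctions

/-! Write `s` for the scaled score `N^{-1/2} X̃'ε` and `G` for `N^{-1} X'X`. Least squares gives `√N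
(β̂ - β) = (G⁻¹ ⊗ I) s`, so under the null hypothesis `T μ̂` is `N^{-1/2} T` applied to the upper
block of `(G⁻¹ ⊗ I) s`. The Moore-Penrose inverse is homogeneous of degree -1, so the powers of `N`
cancel once `D̂` is replaced by `N D̂`. The diagonal of `N D̂` is a polynomial in `s` and a few
nuisance quantities: `N^{-1/2}`, `G⁻¹`, `N / (nᵢ - c - 1)`, and averages of products of covariates
and errors. Hence, for large `N`, the statistic is one fixed function `studentizedForm T` of the
score and the nuisance quantities (`mancats_modelOutcome`).

The nuisance quantities converge in probability to constants by Chebyshev's inequality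
(`tendstoInMeasure_nuisance`). The score is asymptotically `N(0, Ψ)`
(`tendstoInDistribution_scaledScore`): each linear form in it is a sum of independent terms, and
Lyapunov's condition holds because the errors have bounded third moments while each single covariate
vector has squared norm `o(N)`, uniformly over the sample. The latter follows from the convergence
of averages alone (`eventually_forall_le_mul_of_tendsto_average`). Slutsky's theorem gives joint
convergence.

The pseudoinverse is discontinuous in general, but for an orthogonal projector `T` and positive
definite `D` one has `(TDT)⁺ = T (TDT + 1 - T)⁻¹`, an ordinary inverse (`pinv_projector_mul_mul`).
In the limit `N D̂` becomes `D`, whose diagonal is positive even if the `Σᵢ` are singular, so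
`studentizedForm T` is continuous at every limit point and the continuous mapping theorem applies.

The limit is `u'Wu` with `W = T (TDT)⁺ T` and `u ~ N(0, Λ₁₁)`. Factoring `Λ₁₁ = AA'` with `A'WA`
diagonal turns it into a weighted sum of squares of independent standard normals. The weights are
the eigenvalues of `WΛ₁₁ = WAA'`, since this matrix and `A'WA` have the same characteristic
polynomial. -/

theorem norm_exp_mul_I_sub_taylor_le (x : ℝ) :
    ‖Complex.exp (x * Complex.I) - (1 + x * Complex.I - x ^ 2 / 2)‖ ≤ 4 * |x| ^ 3 := by
  have hn : ‖(x : ℂ) * Complex.I‖ = |x| := by simp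
  -- For `|x| ≤ 1` this is the exponential remainder. For `|x| > 1` the terms are bounded separately
  -- by `1 + 1 + |x| + |x|²/2 ≤ 4|x|³`.
  rcases le_or_gt |x| 1 with h | h
  · have := Complex.exp_bound (x := (x : ℂ) * Complex.I) (by rw [hn]; exact h) (n := 3) (by norm_num)
    rw [hn] at this
    have e : ∑ m ∈ Finset.range 3, ((x : ℂ) * Complex.I) ^ m / (m.factorial : ℂ)
        = 1 + x * Complex.I - x ^ 2 / 2 := by
      simp [Finset.sum_range_succ, Nat.factorial, mul_pow]
      ring
    rw [e] at this
    refine this.trans ?_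
    norm_num [Nat.factorial]
    nlinarith [pow_nonneg (abs_nonneg x) 3]
  · have h1 : ‖Complex.exp (x * Complex.I)‖ = 1 := Complex.norm_exp_ofReal_mul_I x
    have h2 : ‖(x : ℂ) ^ 2 / 2‖ = |x| ^ 2 / 2 := by simp
    calc _ ≤ ‖Complex.exp (x * Complex.I)‖ + ‖1 + (x : ℂ) * Complex.I - x ^ 2 / 2‖ :=
          norm_sub_le _ _
      _ ≤ 1 + (1 + |x| + |x| ^ 2 / 2) := by
          rw [h1]
          gcongr
          refine (norm_sub_le _ _).trans ?_
          rw [h2]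
          gcongr
          refine (norm_add_le _ _).trans ?_
          rw [hn]; simp
      _ ≤ 4 * |x| ^ 3 := by
          have h3 : |x| ≤ |x| ^ 3 := le_self_pow₀ h.le (by norm_num)
          have h4 : |x| ^ 2 ≤ |x| ^ 3 := pow_le_pow_right₀ h.le (by norm_num)
          have h5 : (1 : ℝ) ≤ |x| ^ 3 := one_le_pow₀ h.le
          linarith

theorem abs_exp_neg_sub_le {u : ℝ} (hu : 0 ≤ u) : |Real.exp (-u) - (1 - u)| ≤ u ^ 2 := by
  rcases le_or_gt u 1 with h | h
  · have := Real.abs_exp_sub_one_sub_id_le (x := -u) (by rw [abs_neg, abs_of_nonneg hu]; exact h)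
    simpa [sub_sub, sub_eq_add_neg, add_assoc, add_comm, add_left_comm] using this
  · have h1 := Real.add_one_le_exp (-u)
    have h2 : Real.exp (-u) ≤ 1 := Real.exp_le_one_iff.mpr (by linarith)
    rw [abs_of_nonneg (by linarith)]
    nlinarith

/-- Factors are exchanged one at a time; the remaining ones have norm at most one and do not enlarge
the error. -/
theorem norm_prod_sub_prod_le {ι : Type*} (s : Finset ι) (f g : ι → ℂ)
    (hf : ∀ i, ‖f i‖ ≤ 1) (hg : ∀ i, ‖g i‖ ≤ 1) :
    ‖∏ i ∈ s, f i - ∏ i ∈ s, g i‖ ≤ ∑ i ∈ s, ‖f i - g i‖ := by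
  classical
  induction s using Finset.induction_on with
  | empty => simp
  | insert i s hi ih =>
    rw [Finset.prod_insert hi, Finset.prod_insert hi, Finset.sum_insert hi]
    have hp : ‖∏ i ∈ s, f i‖ ≤ 1 := by
      rw [norm_prod]
      exact Finset.prod_le_one (fun _ _ => norm_nonneg _) fun j _ => hf j
    calc ‖f i * ∏ i ∈ s, f i - g i * ∏ i ∈ s, g i‖
        = ‖(f i - g i) * ∏ i ∈ s, f i + g i * (∏ i ∈ s, f i - ∏ i ∈ s, g i)‖ := by ring_nf
      _ ≤ ‖f i - g i‖ * ‖∏ i ∈ s, f i‖ + ‖g i‖ * ‖∏ i ∈ s, f i - ∏ i ∈ s, g i‖ := by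
          refine (norm_add_le _ _).trans ?_
          rw [norm_mul, norm_mul]
      _ ≤ ‖f i - g i‖ * 1 + 1 * ∑ i ∈ s, ‖f i - g i‖ := by
          gcongr
          exact hg i
      _ = _ := by ring

variable {Ω : Type*} [MeasurableSpace Ω] {P : Measure Ω} [IsProbabilityMeasure P]

/-- Both quantities are compared with `1 - v/2`, where `v` is the variance: the first by integrating
the second-order Taylor bound of `exp(ix)`, whose linear term has mean zero. -/
theorem norm_charFun_sub_exp_le {X : Ω → ℝ} (hX : MemLp X 3 P) (hmean : ∫ ω, X ω ∂P = 0) :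
    ‖∫ ω, Complex.exp (X ω * Complex.I) ∂P - (Real.exp (-((∫ ω, X ω ^ 2 ∂P) / 2)) : ℂ)‖
      ≤ 4 * ∫ ω, |X ω| ^ 3 ∂P + (∫ ω, X ω ^ 2 ∂P) ^ 2 := by
  have hX2 : MemLp X 2 P := hX.mono_exponent (by norm_num)
  have i1 : Integrable X P := hX.integrable (by norm_num)
  have i2 : Integrable (fun ω => X ω ^ 2) P := hX2.integrable_sq
  have i3 : Integrable (fun ω => |X ω| ^ 3) P := by
    have := hX.integrable_norm_pow (p := 3) (by norm_num)
    simpa using this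
  have ie : Integrable (fun ω => Complex.exp (X ω * Complex.I)) P := by
    refine Integrable.of_bound (C := 1) ?_ ?_
    · have := hX.aestronglyMeasurable.aemeasurable
      exact AEMeasurable.aestronglyMeasurable (by fun_prop)
    · exact ae_of_all _ fun ω => by simp [Complex.norm_exp_ofReal_mul_I]
  have i1c : Integrable (fun ω => (X ω : ℂ) * Complex.I) P := i1.ofReal.mul_const _
  have i2c : Integrable (fun ω => (X ω : ℂ) ^ 2 / 2) P := by
    have : Integrable (fun ω => ((X ω ^ 2 : ℝ) : ℂ)) P := i2.ofReal
    simpa using this.div_const 2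
  have i01 : Integrable (fun ω => 1 + (X ω : ℂ) * Complex.I) P := (integrable_const _).add i1c
  have ip : Integrable (fun ω => 1 + (X ω : ℂ) * Complex.I - (X ω : ℂ) ^ 2 / 2) P := i01.sub i2c
  set v := ∫ ω, X ω ^ 2 ∂P with hv
  have hv0 : 0 ≤ v := integral_nonneg fun ω => sq_nonneg _
  have hpoly : ∫ ω, (1 + (X ω : ℂ) * Complex.I - (X ω : ℂ) ^ 2 / 2) ∂P = ((1 - v / 2 : ℝ) : ℂ) := by
    rw [integral_sub i01 i2c, integral_add (integrable_const _) i1c,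
      integral_mul_const, integral_div]
    have e1 : ∫ ω, (X ω : ℂ) ∂P = 0 := by rw [integral_complex_ofReal, hmean]; simp
    have e2 : ∫ ω, (X ω : ℂ) ^ 2 ∂P = (v : ℂ) := by
      rw [hv, ← integral_complex_ofReal]; simp
    rw [e1, e2]; simp
  have hb1 : ‖∫ ω, Complex.exp (X ω * Complex.I) ∂P - ((1 - v / 2 : ℝ) : ℂ)‖
      ≤ 4 * ∫ ω, |X ω| ^ 3 ∂P := by
    rw [← hpoly, ← integral_sub ie ip,
      ← integral_const_mul]
    exact norm_integral_le_of_norm_le (i3.const_mul 4)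
      (ae_of_all _ fun ω => norm_exp_mul_I_sub_taylor_le (X ω))
  have hb2 : ‖((1 - v / 2 : ℝ) : ℂ) - (Real.exp (-(v / 2)) : ℂ)‖ ≤ v ^ 2 := by
    rw [← Complex.ofReal_sub, Complex.norm_real, Real.norm_eq_abs, abs_sub_comm]
    refine (abs_exp_neg_sub_le (by positivity)).trans ?_
    nlinarith [sq_nonneg v]
  calc _ ≤ ‖∫ ω, Complex.exp (X ω * Complex.I) ∂P - ((1 - v / 2 : ℝ) : ℂ)‖ +
        ‖((1 - v / 2 : ℝ) : ℂ) - (Real.exp (-(v / 2)) : ℂ)‖ := norm_sub_le_norm_sub_add_norm_sub _ _ _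
    _ ≤ _ := add_le_add hb1 hb2

/-- Lyapunov's central limit theorem for triangular arrays, in terms of the characteristic
functions of the row sums. -/
theorem tendsto_integral_exp_sum_of_lyapunov {ι : ℕ → Type*} [∀ N, Fintype (ι N)]
    (X : ∀ N, ι N → Ω → ℝ) (hindep : ∀ N, iIndepFun (X N) P) (hX : ∀ N s, MemLp (X N s) 3 P)
    (hmean : ∀ N s, ∫ ω, X N s ω ∂P = 0) {v : ℝ}
    (hv : Tendsto (fun N => ∑ s, ∫ ω, X N s ω ^ 2 ∂P) atTop (𝓝 v))
    (hv2 : Tendsto (fun N => ∑ s, (∫ ω, X N s ω ^ 2 ∂P) ^ 2) atTop (𝓝 0))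
    (h3 : Tendsto (fun N => ∑ s, ∫ ω, |X N s ω| ^ 3 ∂P) atTop (𝓝 0)) :
    Tendsto (fun N => ∫ ω, Complex.exp ((∑ s, X N s ω : ℝ) * Complex.I) ∂P) atTop
      (𝓝 (Real.exp (-(v / 2)) : ℂ)) := by
  have hprod : ∀ N, ∫ ω, Complex.exp ((∑ s, X N s ω : ℝ) * Complex.I) ∂P
      = ∏ s, ∫ ω, Complex.exp (X N s ω * Complex.I) ∂P := by
    intro N
    have hm : ∀ s, AEMeasurable (X N s) P := fun s => (hX N s).aestronglyMeasurable.aemeasurable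
    have hcf : ∀ {Z : Ω → ℝ}, AEMeasurable Z P →
        charFun (P.map Z) 1 = ∫ ω, Complex.exp (Z ω * Complex.I) ∂P := by
      intro Z hZ
      rw [charFun_apply_real, integral_map hZ (by fun_prop)]
      simp
    have := congrFun ((hindep N).charFun_map_fun_sum_eq_prod hm) 1
    rw [hcf (Finset.aemeasurable_fun_sum _ fun s _ => hm s), Finset.prod_apply] at this
    rw [this]
    exact Finset.prod_congr rfl fun s _ => hcf (hm s)
  have hexp : ∀ N, ∏ s, (Real.exp (-((∫ ω, X N s ω ^ 2 ∂P) / 2)) : ℂ)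
      = (Real.exp (-((∑ s, ∫ ω, X N s ω ^ 2 ∂P) / 2)) : ℂ) := by
    intro N
    rw [← Complex.ofReal_prod, ← Real.exp_sum, Finset.sum_neg_distrib, Finset.sum_div]
  have hlim : Tendsto (fun N => (Real.exp (-((∑ s, ∫ ω, X N s ω ^ 2 ∂P) / 2)) : ℂ)) atTop
      (𝓝 (Real.exp (-(v / 2)) : ℂ)) := by
    have : Continuous fun r : ℝ => ((Real.exp (-(r / 2)) : ℝ) : ℂ) := by fun_prop
    exact (this.tendsto v).comp hv
  -- Each factor of the characteristic function is exchanged for the Gaussian factor with the same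
  -- variance.
  have hbound : ∀ N, ‖∫ ω, Complex.exp ((∑ s, X N s ω : ℝ) * Complex.I) ∂P
      - (Real.exp (-((∑ s, ∫ ω, X N s ω ^ 2 ∂P) / 2)) : ℂ)‖
      ≤ 4 * ∑ s, ∫ ω, |X N s ω| ^ 3 ∂P + ∑ s, (∫ ω, X N s ω ^ 2 ∂P) ^ 2 := by
    intro N
    rw [hprod, ← hexp]
    refine (norm_prod_sub_prod_le _ _ _ ?_ ?_).trans ?_
    · intro s
      refine (norm_integral_le_of_norm_le_const (C := 1) (ae_of_all _ fun ω => ?_)).trans ?_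
      · simp [Complex.norm_exp_ofReal_mul_I]
      · simp
    · intro s
      rw [Complex.norm_real, Real.norm_eq_abs, Real.abs_exp]
      refine Real.exp_le_one_iff.mpr ?_
      have : 0 ≤ ∫ ω, X N s ω ^ 2 ∂P := integral_nonneg fun ω => sq_nonneg _
      linarith
    · rw [Finset.mul_sum, ← Finset.sum_add_distrib]
      exact Finset.sum_le_sum fun s _ => norm_charFun_sub_exp_le (hX N s) (hmean N s)
  have hdiff : Tendsto (fun N => ∫ ω, Complex.exp ((∑ s, X N s ω : ℝ) * Complex.I) ∂P
      - (Real.exp (-((∑ s, ∫ ω, X N s ω ^ 2 ∂P) / 2)) : ℂ)) atTop (𝓝 0) := by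
    refine squeeze_zero_norm hbound ?_
    simpa using (h3.const_mul 4).add hv2
  simpa using hdiff.add hlim

end CharacteristicFunctions

/-! ### Negligibility of single terms, and a weak law of large numbers. -/

section Averages

/-- If the averages of a nonnegative sequence converge along sample sizes `m N` proportional to
`N`, then every one of the first `m N` terms is small compared with `N`. -/
theorem eventually_forall_le_mul_of_tendsto_average {y : ℕ → ℝ} (hy : ∀ j, 0 ≤ y j) {m : ℕ → ℕ}
    {l : ℝ} (hl : Tendsto (fun N : ℕ => (N : ℝ)⁻¹ * ∑ j ∈ Finset.range (m N), y j) atTop (𝓝 l))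
    {δ : ℝ} (hδ : 0 < δ) : ∀ᶠ N : ℕ in atTop, ∀ j < m N, y j ≤ δ * N := by
  set F : ℕ → ℝ := fun N => (N : ℝ)⁻¹ * ∑ j ∈ Finset.range (m N), y j with hF
  -- Tolerance `δ/4` makes consecutive averages differ by less than `δ/2`; tolerance `1` bounds them
  -- by `|l| + 1`.
  obtain ⟨N₀, hN₀⟩ := Metric.tendsto_atTop.mp hl (min (δ / 4) 1) (by positivity)
  have hmul : ∀ N : ℕ, 1 ≤ N → ∑ j ∈ Finset.range (m N), y j = N * F N := by
    intro N hN
    have : (N : ℝ) ≠ 0 := by positivity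
    simp [hF, this]
  set B : ℝ := |l| + 1 + ∑ j ∈ Finset.range (m (N₀ + 1)), y j with hB
  have hS0 : ∀ k, 0 ≤ ∑ j ∈ Finset.range k, y j := fun k => Finset.sum_nonneg fun j _ => hy j
  -- Induction on `N`, without monotonicity of `m`. A term already present at `N` inherits its
  -- bound. One that enters at `N + 1` is at most `(N+1) F(N+1) - N F(N) = N (F(N+1) - F(N)) +
  -- F(N+1)`, hence at most `δN/2 + |l| + 1`. The constant `B` also covers the terms of the initial
  -- sample, and is eventually below `δN/2`.
  have key : ∀ N, N₀ + 1 ≤ N → ∀ j < m N, y j ≤ δ / 2 * N + B := by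
    intro N hN
    induction N, hN using Nat.le_induction with
    | base =>
      intro j hj
      have h1 : y j ≤ ∑ j ∈ Finset.range (m (N₀ + 1)), y j :=
        Finset.single_le_sum (fun i _ => hy i) (Finset.mem_range.mpr hj)
      have h2 : 0 ≤ δ / 2 * ((N₀ + 1 : ℕ) : ℝ) := by positivity
      have := abs_nonneg l
      linarith
    | succ N hN ih =>
      intro j hj
      by_cases hjN : j < m N
      · have := ih j hjN
        push_cast
        nlinarith
      · push Not at hjN
        have h1 : y j + ∑ i ∈ Finset.range (m N), y i ≤ ∑ i ∈ Finset.range (m (N + 1)), y i := by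
          rw [← Finset.sum_insert (s := Finset.range (m N)) (by simpa using hjN)]
          refine Finset.sum_le_sum_of_subset_of_nonneg (fun i hi => ?_) fun i _ _ => hy i
          rw [Finset.mem_insert, Finset.mem_range] at hi
          rw [Finset.mem_range]
          omega
        rw [hmul N (by omega), hmul (N + 1) (by omega)] at h1
        have hd1 := hN₀ N (by omega)
        have hd2 := hN₀ (N + 1) (by omega)
        rw [Real.dist_eq] at hd1 hd2
        have a1 := abs_lt.mp (lt_of_lt_of_le hd1 (min_le_left _ _))
        have a2 := abs_lt.mp (lt_of_lt_of_le hd2 (min_le_left _ _))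
        have a3 := abs_lt.mp (lt_of_lt_of_le hd2 (min_le_right _ _))
        have hle := le_abs_self l
        have hs := hS0 (m (N₀ + 1))
        push_cast at h1 ⊢
        have hNn : (0 : ℝ) ≤ N := by positivity
        have : (N : ℝ) * (F (N + 1) - F N) ≤ N * (δ / 2) := by
          apply mul_le_mul_of_nonneg_left _ hNn
          linarith
        nlinarith
  have hev : ∀ᶠ N : ℕ in atTop, B ≤ δ / 2 * N := by
    have : Tendsto (fun N : ℕ => δ / 2 * (N : ℝ)) atTop atTop :=
      Tendsto.const_mul_atTop (by positivity) tendsto_natCast_atTop_atTop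
    exact this.eventually_ge_atTop B
  filter_upwards [hev, eventually_ge_atTop (N₀ + 1)] with N h1 h2 j hj
  have := key N h2 j hj
  linarith

variable {Ω : Type*} [MeasurableSpace Ω] {P : Measure Ω} [IsProbabilityMeasure P]

/-- A weak law of large numbers for weighted averages of independent variables with a common
mean. -/
theorem tendstoInMeasure_average {ζ : ℕ → Ω → ℝ} (hindep : Pairwise fun i j => ζ i ⟂ᵢ[P] ζ j)
    (hζ : ∀ j, MemLp (ζ j) 2 P) {e : ℕ → ℝ} (hmean : ∀ j, ∫ ω, ζ j ω ∂P = e j) {B : ℕ → ℝ}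
    (hvar : ∀ j, Var[ζ j; P] ≤ B j) {m : ℕ → ℕ} {l : ℝ}
    (he : Tendsto (fun N => 1 / (m N : ℝ) * ∑ j ∈ Finset.range (m N), e j) atTop (𝓝 l))
    (hB : Tendsto (fun N => (1 / (m N : ℝ)) ^ 2 * ∑ j ∈ Finset.range (m N), B j) atTop (𝓝 0)) :
    TendstoInMeasure P (fun N ω => 1 / (m N : ℝ) * ∑ j ∈ Finset.range (m N), ζ j ω) atTop
      (fun _ => l) := by
  rw [tendstoInMeasure_iff_dist]
  intro δ hδ
  set A : ℕ → Ω → ℝ := fun N ω => 1 / (m N : ℝ) * ∑ j ∈ Finset.range (m N), ζ j ω with hA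
  have hL : ∀ N, MemLp (A N) 2 P := fun N =>
    (memLp_finsetSum _ fun j _ => hζ j).const_mul _
  have hE : ∀ N, ∫ ω, A N ω ∂P = 1 / (m N : ℝ) * ∑ j ∈ Finset.range (m N), e j := by
    intro N
    rw [hA, integral_const_mul, integral_finsetSum _ fun j _ => (hζ j).integrable (by norm_num)]
    simp [hmean]
  have hV : ∀ N, Var[A N; P] ≤ (1 / (m N : ℝ)) ^ 2 * ∑ j ∈ Finset.range (m N), B j := by
    intro N
    have e1 : (fun ω => ∑ j ∈ Finset.range (m N), ζ j ω) = ∑ j ∈ Finset.range (m N), ζ j := by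
      ext ω; simp
    have : Var[A N; P] = (1 / (m N : ℝ)) ^ 2 * ∑ j ∈ Finset.range (m N), Var[ζ j; P] := by
      rw [hA, variance_const_mul, e1, IndepFun.variance_sum (fun j _ => hζ j)
        (fun i _ j _ hij => hindep hij)]
    rw [this]
    gcongr with j
    exact hvar j
  have hbig : Tendsto (fun N => ENNReal.ofReal
      ((1 / (m N : ℝ)) ^ 2 * (∑ j ∈ Finset.range (m N), B j) / (δ / 2) ^ 2)) atTop (𝓝 0) := by
    have := ENNReal.tendsto_ofReal (hB.div_const ((δ / 2) ^ 2))
    simpa using this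
  refine tendsto_of_tendsto_of_tendsto_of_le_of_le' tendsto_const_nhds hbig
    (Eventually.of_forall fun _ => bot_le) ?_
  filter_upwards [(Metric.tendsto_nhds.mp he) (δ / 2) (by positivity)] with N hN
  -- The mean is already within `δ/2` of `l`, so a deviation of `δ` from `l` forces one of `δ/2`
  -- from the mean, and Chebyshev's inequality applies.
  refine le_trans (measure_mono ?_) ((meas_ge_le_variance_div_sq (hL N) (c := δ / 2)
    (by positivity)).trans (ENNReal.ofReal_le_ofReal (by gcongr; exact hV N)))
  intro ω hω
  simp only [Set.mem_ofPred_eq] at hω ⊢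
  rw [hE N, ← Real.dist_eq]
  have := dist_triangle (A N ω) (1 / (m N : ℝ) * ∑ j ∈ Finset.range (m N), e j) l
  linarith

end Averages

/-! ### The continuous mapping theorem. -/

section Mapping

variable {Ω Ω' E F : Type*} [MeasurableSpace Ω] {P : Measure Ω} [IsProbabilityMeasure P]
  [MeasurableSpace Ω'] {P' : Measure Ω'} [IsProbabilityMeasure P']
  [TopologicalSpace E] [MeasurableSpace E] [OpensMeasurableSpace E] [HasOuterApproxClosed E]
  [TopologicalSpace F] [MeasurableSpace F] [BorelSpace F]

/-- The continuous mapping theorem for a function that is continuous at almost every point of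
the limit. -/
theorem tendstoInDistribution_comp_of_ae_continuousAt {X : ℕ → Ω → E} {Z : Ω' → E}
    (h : TendstoInDistribution X atTop Z (fun _ => P) P') {g : E → F} (hg : Measurable g)
    (hc : ∀ᵐ ω ∂P', ContinuousAt g (Z ω)) {A : ℕ → Ω → F} (hA : ∀ N, AEMeasurable (A N) P)
    (hAg : ∀ᶠ N in atTop, ∀ ω, A N ω = g (X N ω)) :
    TendstoInDistribution A atTop (fun ω => g (Z ω)) (fun _ => P) P' where
  forall_aemeasurable := hA
  aemeasurable_limit := hg.comp_aemeasurable h.aemeasurable_limit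
  tendsto := by
    -- Portmanteau criterion. The preimage of a closed `S` need not be closed, so its closure is
    -- used; a point of that closure at which `g` is continuous is still mapped into `S`.
    refine tendsto_of_forall_isClosed_limsup_le' fun S hS => ?_
    have hX := h.forall_aemeasurable
    have hZ := h.aemeasurable_limit
    have h1 := ProbabilityMeasure.limsup_measure_closed_le_of_tendsto h.tendsto
      (isClosed_closure (s := g ⁻¹' S))
    simp only [ProbabilityMeasure.coe_mk] at h1 ⊢
    rw [Measure.map_apply_of_aemeasurable hZ isClosed_closure.measurableSet] at h1
    have hgZ : AEMeasurable (fun ω => g (Z ω)) P' := hg.comp_aemeasurable hZ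
    rw [Measure.map_apply_of_aemeasurable hgZ hS.measurableSet]
    refine le_trans (limsup_le_limsup ?_) (h1.trans (measure_mono_ae ?_))
    · filter_upwards [hAg] with N hN
      rw [Measure.map_apply_of_aemeasurable (hA N) hS.measurableSet,
        Measure.map_apply_of_aemeasurable (hX N) isClosed_closure.measurableSet]
      refine measure_mono fun ω hω => subset_closure ?_
      simpa [← hN ω] using hω
    · filter_upwards [hc] with ω hω hmem
      have : g (Z ω) ∈ closure (g '' (g ⁻¹' S)) :=
        mem_closure_image hω hmem
      exact hS.closure_subset_iff.mpr (Set.image_preimage_subset g S) this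

end Mapping


/-! ### Pseudoinverses: measurability, continuity along a projector, simultaneous diagonalization.
-/

section PseudoInverse

variable {m n r d : Type*} [Fintype m] [Fintype n] [Fintype r] [Fintype d]

theorem IsMoorePenrose.pinv_eq {A : Matrix m n ℝ} {B : Matrix n m ℝ} (h : IsMoorePenrose A B) :
    pinv A = B :=
  (pinv_spec A).unique h

/-- This homogeneity makes the powers of `N` cancel in the statistic. -/
theorem pinv_smul {c : ℝ} (hc : c ≠ 0) (A : Matrix m n ℝ) : pinv (c • A) = c⁻¹ • pinv A := by
  refine IsMoorePenrose.pinv_eq ?_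
  have h := pinv_spec A
  refine ⟨?_, ?_, ?_, ?_⟩
  · simp [smul_smul, hc, h.mul_mul_self]
  · simp [smul_smul, hc, h.self_mul_mul]
  · simp [smul_smul, hc, h.symm_left]
  · simp [smul_smul, hc, h.symm_right]

theorem pinv_transpose (A : Matrix m n ℝ) : pinv Aᵀ = (pinv A)ᵀ := by
  refine IsMoorePenrose.pinv_eq ?_
  have h := pinv_spec A
  refine ⟨?_, ?_, ?_, ?_⟩
  · rw [← transpose_mul, ← transpose_mul, ← Matrix.mul_assoc, h.mul_mul_self]
  · rw [← transpose_mul, ← transpose_mul, ← Matrix.mul_assoc, h.self_mul_mul]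
  · rw [← transpose_mul, h.symm_right, h.symm_right]
  · rw [← transpose_mul, h.symm_left, h.symm_left]

/-- The Moore-Penrose inverse is a Borel function of the entries: its graph is closed. -/
theorem measurable_pinv :
    Measurable fun (A : m → n → ℝ) (i : n) (j : m) => pinv (Matrix.of A) i j := by
  have hG : IsClosed {q : (m → n → ℝ) × (n → m → ℝ) |
      IsMoorePenrose (Matrix.of q.1) (Matrix.of q.2)} := by
    have e : {q : (m → n → ℝ) × (n → m → ℝ) | IsMoorePenrose (Matrix.of q.1) (Matrix.of q.2)} =
        {q | (Matrix.of q.1 : Matrix m n ℝ) * (Matrix.of q.2 : Matrix n m ℝ) * Matrix.of q.1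
          = Matrix.of q.1} ∩
        {q | (Matrix.of q.2 : Matrix n m ℝ) * (Matrix.of q.1 : Matrix m n ℝ) * Matrix.of q.2
          = Matrix.of q.2} ∩
        {q | ((Matrix.of q.1 : Matrix m n ℝ) * (Matrix.of q.2 : Matrix n m ℝ))ᵀ
          = (Matrix.of q.1 : Matrix m n ℝ) * (Matrix.of q.2 : Matrix n m ℝ)} ∩
        {q | ((Matrix.of q.2 : Matrix n m ℝ) * (Matrix.of q.1 : Matrix m n ℝ))ᵀ
          = (Matrix.of q.2 : Matrix n m ℝ) * (Matrix.of q.1 : Matrix m n ℝ)} := by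
      ext q
      exact ⟨fun h => ⟨⟨⟨h.1, h.2⟩, h.3⟩, h.4⟩, fun h => ⟨h.1.1.1, h.1.1.2, h.1.2, h.2⟩⟩
    rw [e]
    have h1 : Continuous fun q : (m → n → ℝ) × (n → m → ℝ) => (Matrix.of q.1 : Matrix m n ℝ) :=
      continuous_fst
    have h2 : Continuous fun q : (m → n → ℝ) × (n → m → ℝ) => (Matrix.of q.2 : Matrix n m ℝ) :=
      continuous_snd
    refine ((IsClosed.inter ?_ ?_).inter ?_).inter ?_
    · exact isClosed_eq ((h1.matrix_mul h2).matrix_mul h1) h1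
    · exact isClosed_eq ((h2.matrix_mul h1).matrix_mul h2) h2
    · exact isClosed_eq (h1.matrix_mul h2).matrix_transpose (h1.matrix_mul h2)
    · exact isClosed_eq (h2.matrix_mul h1).matrix_transpose (h2.matrix_mul h1)
  intro s hs
  have himg : (fun (A : m → n → ℝ) (i : n) (j : m) => pinv (Matrix.of A) i j) ⁻¹' s =
      Prod.fst '' ({q : (m → n → ℝ) × (n → m → ℝ) |
        IsMoorePenrose (Matrix.of q.1) (Matrix.of q.2)} ∩ Prod.snd ⁻¹' s) := by
    ext A
    constructor
    · intro hA
      exact ⟨(A, pinv (Matrix.of A)), ⟨pinv_spec (Matrix.of A), hA⟩, rfl⟩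
    · rintro ⟨⟨A', B⟩, ⟨h, hB⟩, rfl⟩
      have : pinv (Matrix.of A') = Matrix.of B := IsMoorePenrose.pinv_eq h
      simp only [Set.mem_preimage] at hB ⊢
      rw [this]
      exact hB
  rw [himg]
  -- Lusin-Souslin: the first projection is injective on the graph, so it maps Borel subsets of the
  -- graph to Borel sets. Injectivity is the uniqueness of the Moore-Penrose inverse.
  refine MeasurableSet.image_of_measurable_injOn
    (hG.measurableSet.inter (measurable_snd hs)) measurable_fst ?_
  rintro ⟨A, B⟩ ⟨h, -⟩ ⟨A', B'⟩ ⟨h', -⟩ hAA'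
  obtain rfl : A = A' := hAA'
  have hBB' : Matrix.of B = Matrix.of B' := IsMoorePenrose.unique h h'
  exact Prod.ext rfl (Matrix.of.injective hBB')

theorem measurable_pinv_entry {α : Type*} [MeasurableSpace α] {f : α → Matrix m n ℝ}
    (hf : ∀ i j, Measurable fun x => f x i j) (i : n) (j : m) :
    Measurable fun x => pinv (f x) i j := by
  have h1 : Measurable fun x i j => f x i j :=
    measurable_pi_lambda _ fun i => measurable_pi_lambda _ fun j => hf i j
  exact (measurable_pi_apply j).comp ((measurable_pi_apply i).comp (measurable_pinv.comp h1))

theorem measurable_mul_entry {α k l : Type*} [MeasurableSpace α] {f : α → Matrix k n ℝ}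
    {g : α → Matrix n l ℝ} (hf : ∀ i j, Measurable fun x => f x i j)
    (hg : ∀ i j, Measurable fun x => g x i j) (i : k) (j : l) :
    Measurable fun x => (f x * g x) i j := by
  simp only [Matrix.mul_apply]
  exact Finset.measurable_fun_sum _ fun k _ => (hf i k).mul (hg k j)

theorem hypothesisProjector_transpose (H : Matrix r d ℝ) :
    (hypothesisProjector H)ᵀ = hypothesisProjector H := by
  simp [hypothesisProjector, Matrix.mul_assoc, ← pinv_transpose]

theorem hypothesisProjector_mul_self (H : Matrix r d ℝ) :
    hypothesisProjector H * hypothesisProjector H = hypothesisProjector H := by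
  calc hypothesisProjector H * hypothesisProjector H
      = Hᵀ * (pinv (H * Hᵀ) * (H * Hᵀ) * pinv (H * Hᵀ)) * H := by
        simp only [hypothesisProjector, Matrix.mul_assoc]
    _ = _ := by rw [(pinv_spec (H * Hᵀ)).self_mul_mul]; rfl

/-- For an orthogonal projector `T` and a positive definite `D`, the Moore-Penrose inverse of
`T D T` is given by an ordinary inverse. -/
theorem pinv_projector_mul_mul [DecidableEq d] {T D : Matrix d d ℝ} (hT : Tᵀ = T)
    (hTT : T * T = T) (hD : D.PosDef) :
    -- The added `1 - T` acts as the identity on the kernel of `T`, where `TDT` vanishes.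
    IsUnit (T * D * T + (1 - T)).det ∧
      pinv (T * D * T) = T * (T * D * T + (1 - T))⁻¹ := by
  set G := T * D * T + (1 - T) with hG
  have hDs : Dᵀ = D := by
    have := hD.isHermitian
    rwa [Matrix.IsHermitian, conjTranspose_eq_transpose_of_trivial] at this
  have hGs : Gᵀ = G := by
    simp [hG, hT, hDs, Matrix.mul_assoc]
  have hQQ : (1 - T)ᵀ * (1 - T) = 1 - T := by
    simp [hT, Matrix.mul_sub, Matrix.sub_mul, hTT]
  have hu : IsUnit G := by
    rw [← Matrix.mulVec_injective_iff_isUnit]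
    rw [← Matrix.coe_mulVecLin, ← LinearMap.ker_eq_bot, LinearMap.ker_eq_bot']
    intro v hv
    rw [Matrix.mulVecLin_apply] at hv
    have h0 : v ⬝ᵥ G *ᵥ v = 0 := by rw [hv]; simp
    -- The quadratic form splits into two nonnegative parts, one for each of the complementary
    -- projections of `v`. If it vanishes, so do both projections.
    have h1 : v ⬝ᵥ G *ᵥ v = (T *ᵥ v) ⬝ᵥ D *ᵥ (T *ᵥ v) + ((1 - T) *ᵥ v) ⬝ᵥ ((1 - T) *ᵥ v) := by
      have e1 : (T *ᵥ v) ⬝ᵥ D *ᵥ (T *ᵥ v) = v ⬝ᵥ (T * D * T) *ᵥ v := by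
        nth_rewrite 1 [← hT]
        rw [Matrix.mulVec_transpose, ← Matrix.dotProduct_mulVec]
        simp [Matrix.mul_assoc]
      have e2 : ((1 - T) *ᵥ v) ⬝ᵥ ((1 - T) *ᵥ v) = v ⬝ᵥ (1 - T) *ᵥ v := by
        conv_rhs => rw [← hQQ, ← Matrix.mulVec_mulVec, Matrix.dotProduct_mulVec v,
          Matrix.vecMul_transpose]
      rw [e1, e2, hG, Matrix.add_mulVec, dotProduct_add]
    have h2 : 0 ≤ (T *ᵥ v) ⬝ᵥ D *ᵥ (T *ᵥ v) := by
      simpa using hD.posSemidef.dotProduct_mulVec_nonneg (T *ᵥ v)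
    have h3 : 0 ≤ ((1 - T) *ᵥ v) ⬝ᵥ ((1 - T) *ᵥ v) := by
      exact Finset.sum_nonneg fun i _ => mul_self_nonneg _
    have h4 : (1 - T) *ᵥ v = 0 := by
      rw [← dotProduct_self_eq_zero]; linarith
    have h5 : T *ᵥ v = 0 := by
      by_contra hne
      have := hD.dotProduct_mulVec_pos hne
      simp only [star_trivial] at this
      linarith
    calc v = T *ᵥ v + (1 - T) *ᵥ v := by rw [← Matrix.add_mulVec]; simp
      _ = 0 := by rw [h4, h5, add_zero]
  have hdet : IsUnit G.det := (Matrix.isUnit_iff_isUnit_det G).mp hu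
  refine ⟨hdet, IsMoorePenrose.pinv_eq ?_⟩
  have hTG : T * G = T * D * T := by
    simp [hG, Matrix.mul_add, Matrix.mul_sub, ← Matrix.mul_assoc, hTT]
  have hGT : G * T = T * D * T := by
    simp [hG, Matrix.add_mul, Matrix.sub_mul, Matrix.mul_assoc, hTT]
  -- As `TG = TDT = GT`, both products of `TDT` with `TG⁻¹` equal the symmetric idempotent `T`, and
  -- the Penrose equations follow.
  have hcomm : G⁻¹ * T = T * G⁻¹ := by
    calc G⁻¹ * T = G⁻¹ * (T * G) * G⁻¹ := by
          rw [Matrix.mul_assoc, Matrix.mul_assoc, Matrix.mul_nonsing_inv _ hdet, Matrix.mul_one]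
      _ = T * G⁻¹ := by
          rw [hTG, ← hGT, ← Matrix.mul_assoc, Matrix.nonsing_inv_mul _ hdet, Matrix.one_mul]
  have hAB : T * D * T * (T * G⁻¹) = T := by
    rw [← hGT, Matrix.mul_assoc, ← Matrix.mul_assoc T T, hTT, ← hcomm, ← Matrix.mul_assoc,
      Matrix.mul_nonsing_inv _ hdet, Matrix.one_mul]
  have hBA : T * G⁻¹ * (T * D * T) = T := by
    rw [← hTG, ← hcomm, Matrix.mul_assoc, ← Matrix.mul_assoc T T, hTT, hTG, ← hGT,
      ← Matrix.mul_assoc, Matrix.nonsing_inv_mul _ hdet, Matrix.one_mul]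
  refine ⟨?_, ?_, ?_, ?_⟩
  · rw [hAB, ← Matrix.mul_assoc, ← Matrix.mul_assoc, hTT]
  · rw [hBA, ← Matrix.mul_assoc, hTT]
  · rw [hAB, hT]
  · rw [hBA, hT]

/-- `M ↦ (T diag(M) T)⁺` is continuous at the vectors with positive entries. -/
theorem continuousAt_pinv_projector_diagonal [DecidableEq d] {T : Matrix d d ℝ} (hT : Tᵀ = T)
    (hTT : T * T = T) {M : d → ℝ} (hM : ∀ q, 0 < M q) :
    ContinuousAt (fun v : d → ℝ => pinv (T * diagonal v * T)) M := by
  have hev : ∀ᶠ v in 𝓝 M, ∀ q, 0 < v q := by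
    rw [eventually_all]
    exact fun q => (continuous_apply q).continuousAt.eventually (lt_mem_nhds (hM q))
  have hpd : ∀ v : d → ℝ, (∀ q, 0 < v q) → (diagonal v : Matrix d d ℝ).PosDef :=
    fun v hv => Matrix.posDef_diagonal_iff.mpr hv
  have heq : (fun v : d → ℝ => pinv (T * diagonal v * T)) =ᶠ[𝓝 M]
      fun v => T * (T * diagonal v * T + (1 - T))⁻¹ := by
    filter_upwards [hev] with v hv
    exact (pinv_projector_mul_mul hT hTT (hpd v hv)).2
  refine ContinuousAt.congr ?_ heq.symm
  have hG : Continuous fun v : d → ℝ => T * diagonal v * T + (1 - T) := by fun_prop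
  have hinv : ContinuousAt Inv.inv (T * diagonal M * T + (1 - T)) := by
    refine continuousAt_matrix_inv _ ?_
    have hne : (T * diagonal M * T + (1 - T)).det ≠ 0 :=
      (pinv_projector_mul_mul hT hTT (hpd M hM)).1.ne_zero
    simpa [Ring.inverse_eq_inv'] using continuousAt_inv₀ hne
  have h2 : ContinuousAt (fun v : d → ℝ => (T * diagonal v * T + (1 - T))⁻¹) M :=
    ContinuousAt.comp (f := fun v : d → ℝ => T * diagonal v * T + (1 - T)) hinv hG.continuousAt
  have h3 : Continuous fun B : Matrix d d ℝ => T * B := by fun_prop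
  exact ContinuousAt.comp (f := fun v : d → ℝ => (T * diagonal v * T + (1 - T))⁻¹)
    h3.continuousAt h2

theorem exists_orthogonal_diagonalization [DecidableEq d] {A : Matrix d d ℝ} (hA : A.IsHermitian) :
    ∃ U : Matrix d d ℝ, Uᵀ * U = 1 ∧ U * Uᵀ = 1 ∧ A = U * diagonal hA.eigenvalues * Uᵀ := by
  have h1 : (hA.eigenvectorUnitary : Matrix d d ℝ)ᵀ * hA.eigenvectorUnitary = 1 := by
    have := Unitary.coe_star_mul_self hA.eigenvectorUnitary
    simpa [star_eq_conjTranspose, conjTranspose_eq_transpose_of_trivial] using this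
  refine ⟨hA.eigenvectorUnitary, h1, mul_eq_one_comm.mp h1, ?_⟩
  have := hA.spectral_theorem
  simpa [Unitary.conjStarAlgAut_apply, star_eq_conjTranspose,
    conjTranspose_eq_transpose_of_trivial, Function.comp_def] using this

/-- Simultaneous reduction of a covariance matrix `Λ` and a quadratic form `W`; the diagonal form
lists the eigenvalues of `W Λ`. -/
theorem exists_simultaneous_diagonalization [DecidableEq d] {W V : Matrix d d ℝ} (hW : Wᵀ = W)
    (hV : V.PosSemidef) : ∃ (A : Matrix d d ℝ) (lam : d → ℝ), V = A * Aᵀ ∧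
      Aᵀ * W * A = diagonal lam ∧
      (W * V).charpoly = ∏ q, (Polynomial.X - Polynomial.C (lam q)) := by
  -- A spectral square root, available for singular `V` as well. Rotating it by eigenvectors of
  -- `BᵀWB` leaves `BBᵀ` unchanged and makes the form diagonal.
  obtain ⟨B, hB⟩ : ∃ B : Matrix d d ℝ, V = B * Bᵀ := by
    obtain ⟨U, -, -, hU⟩ := exists_orthogonal_diagonalization hV.isHermitian
    refine ⟨U * diagonal fun q => Real.sqrt (hV.isHermitian.eigenvalues q), ?_⟩
    nth_rewrite 1 [hU]
    have hs : diagonal hV.isHermitian.eigenvalues =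
        diagonal (fun q => Real.sqrt (hV.isHermitian.eigenvalues q)) *
          diagonal fun q => Real.sqrt (hV.isHermitian.eigenvalues q) := by
      rw [diagonal_mul_diagonal]
      congr 1
      funext q
      rw [Real.mul_self_sqrt (hV.eigenvalues_nonneg q)]
    rw [hs]
    simp only [transpose_mul, diagonal_transpose, Matrix.mul_assoc]
  have hsym : (Bᵀ * W * B).IsHermitian := by
    rw [Matrix.IsHermitian, conjTranspose_eq_transpose_of_trivial]
    simp [hW, Matrix.mul_assoc]
  obtain ⟨U, hU1, hU2, hU⟩ := exists_orthogonal_diagonalization hsym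
  have hV' : V = (B * U) * (B * U)ᵀ := by
    rw [transpose_mul, Matrix.mul_assoc B, ← Matrix.mul_assoc U, hU2, Matrix.one_mul, hB]
  have hD : (B * U)ᵀ * W * (B * U) = diagonal hsym.eigenvalues := by
    calc (B * U)ᵀ * W * (B * U) = Uᵀ * (Bᵀ * W * B) * U := by
          simp only [transpose_mul, Matrix.mul_assoc]
      _ = Uᵀ * (U * diagonal hsym.eigenvalues * Uᵀ) * U := by rw [← hU]
      _ = (Uᵀ * U) * diagonal hsym.eigenvalues * (Uᵀ * U) := by simp only [Matrix.mul_assoc]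
      _ = _ := by rw [hU1, Matrix.one_mul, Matrix.mul_one]
  refine ⟨B * U, hsym.eigenvalues, hV', hD, ?_⟩
  rw [hV', ← Matrix.mul_assoc, Matrix.charpoly_mul_comm, ← Matrix.mul_assoc, hD,
    Matrix.charpoly_diagonal]

end PseudoInverse


/-! ### Algebra of the design, the least squares estimator and the residuals. -/

section Design

variable {a p c : ℕ}

/-- The row of the design matrix that belongs to subject `j` of group `i`. -/
def feature (z : Fin a → ℕ → Fin c → ℝ) (i : Fin a) (j : ℕ) : Fin a ⊕ Fin c → ℝ :=
  Sum.elim (fun i' => if i = i' then (1 : ℝ) else 0) (z i j)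

/-- The groupwise averages of the products of two features. -/
noncomputable def crossAverage (n : Fin a → ℕ) (z : Fin a → ℕ → Fin c → ℝ) (i : Fin a)
    (q q' : Fin a ⊕ Fin c) : ℝ :=
  1 / (n i : ℝ) * ∑ j ∈ Finset.range (n i), feature z i j q * feature z i j q'

/-- The entries of `X̃' y`. -/
def score (n : Fin a → ℕ) (z : Fin a → ℕ → Fin c → ℝ) (y : Fin a → ℕ → Fin p → ℝ)
    (q : (Fin a ⊕ Fin c) × Fin p) : ℝ :=
  ∑ i, ∑ j ∈ Finset.range (n i), feature z i j q.1 * y i j q.2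

theorem sum_subj {n : Fin a → ℕ} (f : Fin a → ℕ → ℝ) :
    ∑ s : Subj n, f s.1 s.2 = ∑ i, ∑ j ∈ Finset.range (n i), f i j := by
  rw [Fintype.sum_sigma]
  exact Finset.sum_congr rfl fun i _ => (Finset.sum_range fun j => f i j).symm

theorem gram_apply (n : Fin a → ℕ) (z : Fin a → ℕ → Fin c → ℝ) (q q' : Fin a ⊕ Fin c) :
    ((designMatrix n z)ᵀ * designMatrix n z) q q' =
      ∑ i, ∑ j ∈ Finset.range (n i), feature z i j q * feature z i j q' := by
  rw [Matrix.mul_apply, ← sum_subj (n := n) fun i j => feature z i j q * feature z i j q']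
  rfl

theorem inv_mul_sum_eq (N m : ℕ) (f : ℕ → ℝ) :
    (N : ℝ)⁻¹ * ∑ j ∈ Finset.range m, f j =
      (m : ℝ) / N * (1 / (m : ℝ) * ∑ j ∈ Finset.range m, f j) := by
  rcases Nat.eq_zero_or_pos m with rfl | hm
  · simp
  · field_simp

theorem scaledGram_apply (N : ℕ) (n : Fin a → ℕ) (z : Fin a → ℕ → Fin c → ℝ)
    (q q' : Fin a ⊕ Fin c) :
    scaledGram N n z q q' = ∑ i, (n i : ℝ) / N * crossAverage n z i q q' := by
  rw [scaledGram, Matrix.smul_apply, gram_apply, smul_eq_mul, Finset.mul_sum]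
  exact Finset.sum_congr rfl fun i _ => inv_mul_sum_eq _ _ _

theorem bigDesignMatrix_apply (n : Fin a → ℕ) (z : Fin a → ℕ → Fin c → ℝ) (s : Subj n)
    (k l : Fin p) (q : Fin a ⊕ Fin c) :
    bigDesignMatrix p n z (s, k) (q, l) = if k = l then feature z s.1 s.2 q else 0 := by
  rw [bigDesignMatrix, Matrix.kronecker_apply, Matrix.one_apply, mul_ite, mul_one, mul_zero]
  rfl

theorem errorCov_mul_bigDesignMatrix (n : Fin a → ℕ) (z : Fin a → ℕ → Fin c → ℝ)
    (S : Fin a → Matrix (Fin p) (Fin p) ℝ) (s : Subj n) (k l : Fin p) (q : Fin a ⊕ Fin c) :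
    (errorCov n S * bigDesignMatrix p n z) (s, k) (q, l) = feature z s.1 s.2 q * S s.1 k l := by
  simp only [Matrix.mul_apply, errorCov, Matrix.of_apply, bigDesignMatrix_apply,
    Fintype.sum_prod_type]
  rw [Finset.sum_eq_single s (fun t _ ht => by simp [ht.symm]) (by simp)]
  simp only [if_true, mul_ite, mul_zero, Finset.sum_ite_eq', Finset.mem_univ]
  rw [mul_comm]

theorem scaledMiddle_apply (N : ℕ) (n : Fin a → ℕ) (z : Fin a → ℕ → Fin c → ℝ)
    (S : Fin a → Matrix (Fin p) (Fin p) ℝ) (q q' : Fin a ⊕ Fin c) (k l : Fin p) :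
    scaledMiddle N n z S (q, k) (q', l) =
      ∑ i, (n i : ℝ) / N * crossAverage n z i q q' * S i k l := by
  have h : ((bigDesignMatrix p n z)ᵀ * errorCov n S * bigDesignMatrix p n z) (q, k) (q', l) =
      ∑ i, ∑ j ∈ Finset.range (n i), feature z i j q * feature z i j q' * S i k l := by
    rw [Matrix.mul_assoc, Matrix.mul_apply, Fintype.sum_prod_type,
      ← sum_subj (n := n) fun i j => feature z i j q * feature z i j q' * S i k l]
    refine Finset.sum_congr rfl fun s _ => ?_
    simp only [errorCov_mul_bigDesignMatrix, bigDesignMatrix_apply, Matrix.transpose_apply,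
      ite_mul, zero_mul, Finset.sum_ite_eq', Finset.mem_univ, if_true]
    rw [← mul_assoc]
  rw [scaledMiddle, Matrix.smul_apply, h, smul_eq_mul, Finset.mul_sum]
  refine Finset.sum_congr rfl fun i _ => ?_
  rw [← Finset.sum_mul, ← mul_assoc, inv_mul_sum_eq]
  rfl

theorem bigGram_eq_kronecker (p : ℕ) (n : Fin a → ℕ) (z : Fin a → ℕ → Fin c → ℝ) :
    (bigDesignMatrix p n z)ᵀ * bigDesignMatrix p n z =
      ((designMatrix n z)ᵀ * designMatrix n z) ⊗ₖ (1 : Matrix (Fin p) (Fin p) ℝ) := by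
  rw [bigDesignMatrix, ← Matrix.kroneckerMap_transpose, ← Matrix.mul_kronecker_mul,
    Matrix.transpose_one, Matrix.one_mul]

theorem inv_bigScaledGram (p N : ℕ) (n : Fin a → ℕ) (z : Fin a → ℕ → Fin c → ℝ) :
    (bigScaledGram p N n z)⁻¹ =
      (scaledGram N n z)⁻¹ ⊗ₖ (1 : Matrix (Fin p) (Fin p) ℝ) := by
  rw [bigScaledGram, bigGram_eq_kronecker, ← Matrix.smul_kronecker, Matrix.inv_kronecker, inv_one]
  rfl

/-- The Gram matrix of `X ⊗ I_p` is `X'X ⊗ I_p`, so the multivariate regression decouples into one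
regression per coordinate with a common design. -/
theorem olsEstimator_apply (n : Fin a → ℕ) (z : Fin a → ℕ → Fin c → ℝ)
    (y : Fin a → ℕ → Fin p → ℝ) (q : Fin a ⊕ Fin c) (k : Fin p) :
    olsEstimator n z y (q, k) =
      ∑ q', ((designMatrix n z)ᵀ * designMatrix n z)⁻¹ q q' * score n z y (q', k) := by
  have hs : (bigDesignMatrix p n z)ᵀ *ᵥ outcomeVector n y = score n z y := by
    ext ⟨q', l⟩
    rw [Matrix.mulVec, dotProduct, Fintype.sum_prod_type, score,
      ← sum_subj (n := n) fun i j => feature z i j q' * y i j l]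
    refine Finset.sum_congr rfl fun s _ => ?_
    simp only [bigDesignMatrix_apply, Matrix.transpose_apply, ite_mul, zero_mul,
      Finset.sum_ite_eq', Finset.mem_univ, if_true]
    rfl
  rw [olsEstimator, bigGram_eq_kronecker, Matrix.inv_kronecker, inv_one, ← Matrix.mulVec_mulVec, hs,
    Matrix.mulVec, dotProduct, Fintype.sum_prod_type]
  refine Finset.sum_congr rfl fun q' _ => ?_
  simp only [Matrix.kronecker_apply, Matrix.one_apply, mul_ite, mul_one, mul_zero, ite_mul,
    zero_mul, Finset.sum_ite_eq, Finset.mem_univ, if_true]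

/-- The outcomes generated by the regression coefficients `β` and the errors `e`. -/
def modelOutcome (z : Fin a → ℕ → Fin c → ℝ) (β : (Fin a ⊕ Fin c) × Fin p → ℝ)
    (e : Fin a → ℕ → Fin p → ℝ) (i : Fin a) (j : ℕ) (k : Fin p) : ℝ :=
  ∑ q, feature z i j q * β (q, k) + e i j k

theorem score_modelOutcome (n : Fin a → ℕ) (z : Fin a → ℕ → Fin c → ℝ)
    (β : (Fin a ⊕ Fin c) × Fin p → ℝ) (e : Fin a → ℕ → Fin p → ℝ) (q : Fin a ⊕ Fin c)
    (k : Fin p) :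
    score n z (modelOutcome z β e) (q, k) =
      ∑ q', ((designMatrix n z)ᵀ * designMatrix n z) q q' * β (q', k) + score n z e (q, k) := by
  simp only [score, modelOutcome, mul_add, Finset.sum_add_distrib, gram_apply, Finset.sum_mul,
    Finset.mul_sum]
  congr 1
  rw [Finset.sum_comm (s := Finset.univ (α := Fin a ⊕ Fin c))]
  refine Finset.sum_congr rfl fun i _ => ?_
  rw [Finset.sum_comm]
  exact Finset.sum_congr rfl fun j _ => Finset.sum_congr rfl fun q' _ => by ring

/-- The vector `(K ⊗ I_p) v`. -/
def kronVec (K : Matrix (Fin a ⊕ Fin c) (Fin a ⊕ Fin c) ℝ) (v : (Fin a ⊕ Fin c) × Fin p → ℝ)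
    (q : (Fin a ⊕ Fin c) × Fin p) : ℝ :=
  ∑ q', K q.1 q' * v (q', q.2)

/-- The factor `N⁻¹` relating `(X'X)⁻¹` to the inverse scaled Gram matrix is split into two factors
`N^{-1/2}`: one normalizes the score, the other is the rate of the estimator. -/
theorem olsEstimator_modelOutcome {N : ℕ} (hN : N ≠ 0) {n : Fin a → ℕ}
    {z : Fin a → ℕ → Fin c → ℝ} (hdet : IsUnit (scaledGram N n z).det)
    (β : (Fin a ⊕ Fin c) × Fin p → ℝ) (e : Fin a → ℕ → Fin p → ℝ)
    (q : (Fin a ⊕ Fin c) × Fin p) :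
    olsEstimator n z (modelOutcome z β e) q = β q + (√(N : ℝ))⁻¹ *
      kronVec (scaledGram N n z)⁻¹ (fun q' => (√(N : ℝ))⁻¹ * score n z e q') q := by
  obtain ⟨q, k⟩ := q
  set G := (designMatrix n z)ᵀ * designMatrix n z with hG
  have hN' : (N : ℝ) ≠ 0 := Nat.cast_ne_zero.mpr hN
  have hGs : G = (N : ℝ) • scaledGram N n z := by
    rw [scaledGram, smul_smul, mul_inv_cancel₀ hN', one_smul]
  have hGdet : IsUnit G.det := by
    rw [hGs, Matrix.det_smul]
    exact ((isUnit_iff_ne_zero.mpr hN').pow _).mul hdet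
  have hinv : (scaledGram N n z)⁻¹ = (N : ℝ) • G⁻¹ := by
    refine Matrix.inv_eq_right_inv ?_
    rw [Matrix.mul_smul, ← Matrix.smul_mul, ← hGs, Matrix.mul_nonsing_inv _ hGdet]
  have hs : (√(N : ℝ))⁻¹ * (√(N : ℝ))⁻¹ = (N : ℝ)⁻¹ := by
    rw [← mul_inv, Real.mul_self_sqrt (Nat.cast_nonneg N)]
  have h1 : ∑ q', G⁻¹ q q' * ∑ q'', G q' q'' * β (q'', k) = β (q, k) := by
    have : (G⁻¹ *ᵥ (G *ᵥ fun q'' => β (q'', k))) q = β (q, k) := by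
      rw [Matrix.mulVec_mulVec, Matrix.nonsing_inv_mul _ hGdet, Matrix.one_mulVec]
    exact this
  rw [olsEstimator_apply]
  simp only [score_modelOutcome, ← hG, mul_add, Finset.sum_add_distrib]
  rw [h1, kronVec, Finset.mul_sum]
  congr 1
  refine Finset.sum_congr rfl fun q' _ => ?_
  change _ = _ * ((scaledGram N n z)⁻¹ q q' * (_ * score n z e (q', k)))
  rw [hinv, Matrix.smul_apply, smul_eq_mul]
  calc G⁻¹ q q' * score n z e (q', k)
      = ((N : ℝ)⁻¹ * N) * (G⁻¹ q q' * score n z e (q', k)) := by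
        rw [inv_mul_cancel₀ hN', one_mul]
    _ = _ := by rw [← hs]; ring

theorem residual_modelOutcome {n : Fin a → ℕ} {z : Fin a → ℕ → Fin c → ℝ}
    {β δ : (Fin a ⊕ Fin c) × Fin p → ℝ} {e : Fin a → ℕ → Fin p → ℝ}
    (hδ : ∀ q, olsEstimator n z (modelOutcome z β e) q = β q + δ q) (i : Fin a) (j : ℕ)
    (k : Fin p) :
    residual n z (modelOutcome z β e) i j k = e i j k - ∑ q, feature z i j q * δ (q, k) := by
  have hfit : ∑ q, feature z i j q * (β (q, k) + δ (q, k)) =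
      muHat n z (modelOutcome z β e) (i, k) +
        ∑ w, z i j w * nuHat n z (modelOutcome z β e) (w, k) := by
    simp only [← hδ, Fintype.sum_sum_type, feature, Sum.elim_inl, Sum.elim_inr, muHat, nuHat,
      ite_mul, one_mul, zero_mul, Finset.sum_ite_eq, Finset.mem_univ, if_true]
  simp only [mul_add, Finset.sum_add_distrib] at hfit
  rw [residual, modelOutcome]
  linarith

/-- Expanding the square separates the estimation error `δ` from averages that have limits, so the
residual variance becomes a polynomial in quantities with known asymptotics. -/
theorem average_sq_sub_linear {Q : Type*} [Fintype Q] (m : ℕ) (e : ℕ → ℝ) (f : ℕ → Q → ℝ)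
    (δ : Q → ℝ) :
    1 / (m : ℝ) * ∑ j ∈ Finset.range m, (e j - ∑ q, f j q * δ q) ^ 2 =
      1 / (m : ℝ) * ∑ j ∈ Finset.range m, e j ^ 2
        - 2 * ∑ q, δ q * (1 / (m : ℝ) * ∑ j ∈ Finset.range m, f j q * e j)
        + ∑ q, ∑ q', δ q * δ q' * (1 / (m : ℝ) * ∑ j ∈ Finset.range m, f j q * f j q') := by
  have h2 : ∑ q, δ q * (1 / (m : ℝ) * ∑ j ∈ Finset.range m, f j q * e j) =
      1 / (m : ℝ) * ∑ j ∈ Finset.range m, e j * ∑ q, f j q * δ q := by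
    simp only [Finset.mul_sum]
    rw [Finset.sum_comm]
    exact Finset.sum_congr rfl fun j _ => Finset.sum_congr rfl fun q _ => by ring
  have h3 : ∑ q, ∑ q', δ q * δ q' * (1 / (m : ℝ) * ∑ j ∈ Finset.range m, f j q * f j q') =
      1 / (m : ℝ) * ∑ j ∈ Finset.range m, (∑ q, f j q * δ q) ^ 2 := by
    have h : ∀ j, (∑ q, f j q * δ q) ^ 2 = ∑ q, ∑ q', δ q * δ q' * (f j q * f j q') := by
      intro j
      rw [sq, Finset.sum_mul_sum]
      exact Finset.sum_congr rfl fun q _ => Finset.sum_congr rfl fun q' _ => by ring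
    simp only [h]
    simp only [Finset.mul_sum]
    rw [Finset.sum_comm (s := Finset.range m)]
    refine Finset.sum_congr rfl fun q _ => ?_
    rw [Finset.sum_comm (s := Finset.range m)]
    refine Finset.sum_congr rfl fun q' _ => Finset.sum_congr rfl fun j _ => ?_
    ring
  have h4 : ∀ b : ℝ, 2 * (1 / (m : ℝ) * b) = 1 / (m : ℝ) * (2 * b) := fun b => by ring
  rw [h2, h3, h4, ← mul_sub, ← mul_add, Finset.mul_sum (a := (2 : ℝ)),
    ← Finset.sum_sub_distrib, ← Finset.sum_add_distrib]
  congr 1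
  exact Finset.sum_congr rfl fun j _ => by ring

end Design

/-! ### Deterministic limits of group sizes, Gram matrices and the sandwich covariance. -/

section Limits

variable {a p c : ℕ} {n : ℕ → Fin a → ℕ} {z : Fin a → ℕ → Fin c → ℝ} {κ : Fin a → ℝ}

theorem tendsto_groupSize {i : Fin a} (hκ : 0 < κ i)
    (hκlim : Tendsto (fun N : ℕ => (N : ℝ) / (n N i : ℝ)) atTop (𝓝 (κ i))) :
    Tendsto (fun N => (n N i : ℝ)) atTop atTop := by
  have h1 : ∀ᶠ N : ℕ in atTop, (κ i + 1)⁻¹ * (N : ℝ) ≤ n N i := by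
    filter_upwards [hκlim.eventually (gt_mem_nhds (lt_add_one (κ i))),
      hκlim.eventually (lt_mem_nhds hκ)] with N h h0
    have hn : (0 : ℝ) < n N i := by
      -- An empty group would give `N / 0 = 0`, which positivity of the ratio rules out.
      rcases Nat.eq_zero_or_pos (n N i) with h' | h'
      · simp [h'] at h0
      · exact_mod_cast h'
    rw [div_lt_iff₀ hn] at h
    rw [inv_mul_le_iff₀ (by linarith)]
    exact h.le
  refine tendsto_atTop_mono' _ h1 ?_
  exact Tendsto.const_mul_atTop (by positivity) tendsto_natCast_atTop_atTop

theorem tendsto_groupFraction {i : Fin a} (hκ : 0 < κ i)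
    (hκlim : Tendsto (fun N : ℕ => (N : ℝ) / (n N i : ℝ)) atTop (𝓝 (κ i))) :
    Tendsto (fun N : ℕ => (n N i : ℝ) / N) atTop (𝓝 (κ i)⁻¹) := by
  simpa using hκlim.inv₀ hκ.ne'

theorem tendsto_div_residualDegrees {i : Fin a} (c : ℕ) (hκ : 0 < κ i)
    (hκlim : Tendsto (fun N : ℕ => (N : ℝ) / (n N i : ℝ)) atTop (𝓝 (κ i))) :
    Tendsto (fun N : ℕ => (N : ℝ) / ((n N i : ℝ) - c - 1)) atTop (𝓝 (κ i)) := by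
  have hn := tendsto_groupSize hκ hκlim
  have h1 : Tendsto (fun N : ℕ => 1 - ((c : ℝ) + 1) / (n N i : ℝ)) atTop (𝓝 1) := by
    simpa using tendsto_const_nhds.sub (hn.const_div_atTop ((c : ℝ) + 1))
  have h2 := hκlim.div h1 one_ne_zero
  rw [div_one] at h2
  refine h2.congr' ?_
  filter_upwards [hn.eventually_gt_atTop 0] with N hN
  simp only [Pi.div_apply]
  rw [div_div]
  congr 1
  field_simp
  ring

theorem exists_tendsto_crossAverage (hκ : ∀ i, 0 < κ i)
    (hκlim : ∀ i, Tendsto (fun N : ℕ => (N : ℝ) / (n N i : ℝ)) atTop (𝓝 (κ i)))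
    {cbar : Fin a → Fin c → ℝ}
    (hcbar : ∀ i w, Tendsto (fun N : ℕ => 1 / (n N i : ℝ) * ∑ j : Fin (n N i), z i j w)
      atTop (𝓝 (cbar i w)))
    {Ξg : Fin a → Matrix (Fin c) (Fin c) ℝ}
    (hΞg : ∀ i, Tendsto
      (fun N : ℕ => (1 / (n N i : ℝ)) • ∑ j : Fin (n N i), vecMulVec (z i j) (z i j))
      atTop (𝓝 (Ξg i))) :
    ∃ C : Fin a → Fin a ⊕ Fin c → Fin a ⊕ Fin c → ℝ, ∀ i q q',
      Tendsto (fun N => crossAverage (n N) z i q q') atTop (𝓝 (C i q q')) := by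
  suffices h : ∀ i q q', ∃ l, Tendsto (fun N => crossAverage (n N) z i q q') atTop (𝓝 l) by
    choose C hC using h
    exact ⟨C, hC⟩
  have hz : ∀ i w, Tendsto (fun N : ℕ => 1 / (n N i : ℝ) * ∑ j ∈ Finset.range (n N i), z i j w)
      atTop (𝓝 (cbar i w)) := by
    intro i w
    simpa only [Finset.sum_range] using hcbar i w
  intro i q q'
  rcases q with i₁ | w <;> rcases q' with i₂ | w'
  · refine ⟨(if i = i₁ then 1 else 0) * (if i = i₂ then 1 else 0), ?_⟩
    refine tendsto_const_nhds.congr' ?_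
    filter_upwards [(tendsto_groupSize (hκ i) (hκlim i)).eventually_gt_atTop 0] with N hN
    simp only [crossAverage, feature, Sum.elim_inl, Finset.sum_const, Finset.card_range,
      nsmul_eq_mul]
    field_simp
  · refine ⟨(if i = i₁ then 1 else 0) * cbar i w', ?_⟩
    refine ((hz i w').const_mul (if i = i₁ then 1 else 0)).congr fun N => ?_
    simp only [crossAverage, feature, Sum.elim_inl, Sum.elim_inr, ← Finset.mul_sum]
    ring
  · refine ⟨cbar i w * (if i = i₂ then 1 else 0), ?_⟩
    refine ((hz i w).mul_const (if i = i₂ then 1 else 0)).congr fun N => ?_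
    simp only [crossAverage, feature, Sum.elim_inl, Sum.elim_inr, ← Finset.sum_mul]
    ring
  · refine ⟨Ξg i w w', ?_⟩
    have hw : Continuous fun A : Matrix (Fin c) (Fin c) ℝ => A w w' :=
      continuous_id.matrix_elem w w'
    refine ((hw.tendsto _).comp (hΞg i)).congr fun N => ?_
    simp only [Function.comp_apply, crossAverage, feature, Sum.elim_inr, Finset.sum_range,
      Matrix.smul_apply, smul_eq_mul]
    rw [Matrix.sum_apply]
    rfl

variable {C : Fin a → Fin a ⊕ Fin c → Fin a ⊕ Fin c → ℝ}

theorem tendsto_scaledGram (hκ : ∀ i, 0 < κ i)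
    (hκlim : ∀ i, Tendsto (fun N : ℕ => (N : ℝ) / (n N i : ℝ)) atTop (𝓝 (κ i)))
    (hC : ∀ i q q', Tendsto (fun N => crossAverage (n N) z i q q') atTop (𝓝 (C i q q'))) :
    Tendsto (fun N : ℕ => scaledGram N (n N) z) atTop
      (𝓝 (Matrix.of fun q q' => ∑ i, (κ i)⁻¹ * C i q q')) := by
  refine tendsto_pi_nhds.mpr fun q => tendsto_pi_nhds.mpr fun q' => ?_
  simp only [scaledGram_apply]
  exact tendsto_finsetSum _ fun i _ =>
    (tendsto_groupFraction (hκ i) (hκlim i)).mul (hC i q q')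

theorem tendsto_scaledMiddle (hκ : ∀ i, 0 < κ i)
    (hκlim : ∀ i, Tendsto (fun N : ℕ => (N : ℝ) / (n N i : ℝ)) atTop (𝓝 (κ i)))
    (hC : ∀ i q q', Tendsto (fun N => crossAverage (n N) z i q q') atTop (𝓝 (C i q q')))
    (S : Fin a → Matrix (Fin p) (Fin p) ℝ) :
    Tendsto (fun N : ℕ => scaledMiddle N (n N) z S) atTop
      (𝓝 (Matrix.of fun q q' => ∑ i, (κ i)⁻¹ * C i q.1 q'.1 * S i q.2 q'.2)) := by
  refine tendsto_pi_nhds.mpr fun q => tendsto_pi_nhds.mpr fun q' => ?_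
  obtain ⟨q, k⟩ := q
  obtain ⟨q', l⟩ := q'
  simp only [scaledMiddle_apply]
  exact tendsto_finsetSum _ fun i _ =>
    ((tendsto_groupFraction (hκ i) (hκlim i)).mul (hC i q q')).mul_const _

theorem tendsto_inv_of_isUnit_det {m : Type*} [Fintype m] [DecidableEq m]
    {A : ℕ → Matrix m m ℝ} {B : Matrix m m ℝ} (hA : Tendsto A atTop (𝓝 B)) (hB : IsUnit B.det) :
    Tendsto (fun N => (A N)⁻¹) atTop (𝓝 B⁻¹) := by
  have hinv : ContinuousAt Inv.inv B := by
    refine continuousAt_matrix_inv _ ?_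
    simpa [Ring.inverse_eq_inv'] using continuousAt_inv₀ hB.ne_zero
  exact hinv.tendsto.comp hA

theorem eventually_isUnit_det {m : Type*} [Fintype m] [DecidableEq m]
    {A : ℕ → Matrix m m ℝ} {B : Matrix m m ℝ} (hA : Tendsto A atTop (𝓝 B)) (hB : IsUnit B.det) :
    ∀ᶠ N in atTop, IsUnit (A N).det := by
  have h : Tendsto (fun N => (A N).det) atTop (𝓝 B.det) :=
    ((continuous_id.matrix_det).tendsto B).comp hA
  filter_upwards [h.eventually_ne hB.ne_zero] with N hN
  exact isUnit_iff_ne_zero.mpr hN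

theorem tendsto_sandwich {N₀ : Matrix ((Fin a ⊕ Fin c) × Fin p) ((Fin a ⊕ Fin c) × Fin p) ℝ}
    {Ξ : Matrix (Fin a ⊕ Fin c) (Fin a ⊕ Fin c) ℝ} {S : Fin a → Matrix (Fin p) (Fin p) ℝ}
    (hΞ : Tendsto (fun N : ℕ => scaledGram N (n N) z) atTop (𝓝 Ξ)) (hdet : IsUnit Ξ.det)
    (hΨ : Tendsto (fun N : ℕ => scaledMiddle N (n N) z S) atTop (𝓝 N₀)) :
    Tendsto (fun N : ℕ => (bigScaledGram p N (n N) z)⁻¹ * scaledMiddle N (n N) z S *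
        (bigScaledGram p N (n N) z)⁻¹) atTop
      (𝓝 ((Ξ⁻¹ ⊗ₖ (1 : Matrix (Fin p) (Fin p) ℝ)) * N₀ *
        (Ξ⁻¹ ⊗ₖ (1 : Matrix (Fin p) (Fin p) ℝ)))) := by
  simp only [inv_bigScaledGram]
  have hK : Continuous fun A : Matrix (Fin a ⊕ Fin c) (Fin a ⊕ Fin c) ℝ =>
      A ⊗ₖ (1 : Matrix (Fin p) (Fin p) ℝ) := by
    refine continuous_pi fun q => continuous_pi fun q' => ?_
    exact (continuous_id.matrix_elem q.1 q'.1).mul continuous_const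
  have h1 := (hK.tendsto Ξ⁻¹).comp (tendsto_inv_of_isUnit_det hΞ hdet)
  exact (h1.mul hΨ).mul h1

end Limits


/-! ### The statistic as a fixed function of the score and the nuisance quantities. -/

section Studentization

variable {a p c : ℕ}

/-- The averages of the products of a feature and an error. -/
noncomputable def errorFeatureAverage (n : Fin a → ℕ) (z : Fin a → ℕ → Fin c → ℝ)
    (e : Fin a → ℕ → Fin p → ℝ) (q : Fin a × (Fin a ⊕ Fin c) × Fin p) : ℝ :=
  1 / (n q.1 : ℝ) * ∑ j ∈ Finset.range (n q.1), feature z q.1 j q.2.1 * e q.1 j q.2.2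

/-- The averages of the squared errors. -/
noncomputable def errorSqAverage (n : Fin a → ℕ) (e : Fin a → ℕ → Fin p → ℝ)
    (q : Fin a × Fin p) : ℝ :=
  1 / (n q.1 : ℝ) * ∑ j ∈ Finset.range (n q.1), e q.1 j q.2 ^ 2

/-- The space of the quantities that, besides the score, determine the statistic and have constant
limits: the factor `N^{-1/2}`, the inverse scaled Gram matrix, the factors `N / (nᵢ - c - 1)`, the
averages of the products of features, of the squared errors, and of the products of features and
errors. -/
abbrev Nuisance (a p c : ℕ) : Type :=
  (ℝ × (Fin a ⊕ Fin c → Fin a ⊕ Fin c → ℝ) × (Fin a → ℝ) ×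
      (Fin a → Fin a ⊕ Fin c → Fin a ⊕ Fin c → ℝ)) ×
    ((Fin a × Fin p → ℝ) × (Fin a × (Fin a ⊕ Fin c) × Fin p → ℝ))

instance : SecondCountableTopology (Nuisance a p c) := by
  unfold Nuisance
  infer_instance

set_option synthInstance.maxSize 4000 in
instance : BorelSpace (Nuisance a p c) := by
  unfold Nuisance
  infer_instance

/-- The diagonal of `N D̂` as a function of the score and the nuisance quantities. -/
def scaledVariance (x : EuclideanSpace ℝ ((Fin a ⊕ Fin c) × Fin p) × Nuisance a p c)
    (q : Fin a × Fin p) : ℝ :=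
  x.2.1.2.2.1 q.1 * (x.2.2.1 q
    - 2 * ∑ w, x.2.1.1 * kronVec (Matrix.of x.2.1.2.1) x.1 (w, q.2) * x.2.2.2 (q.1, w, q.2)
    + ∑ w, ∑ w', x.2.1.1 * kronVec (Matrix.of x.2.1.2.1) x.1 (w, q.2) *
        (x.2.1.1 * kronVec (Matrix.of x.2.1.2.1) x.1 (w', q.2)) * x.2.1.2.2.2 q.1 w w')

/-- The MANCATS statistic as a function of the score and the nuisance quantities. -/
noncomputable def studentizedForm (T : Matrix (Fin a × Fin p) (Fin a × Fin p) ℝ)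
    (x : EuclideanSpace ℝ ((Fin a ⊕ Fin c) × Fin p) × Nuisance a p c) : ℝ :=
  (fun q => kronVec (Matrix.of x.2.1.2.1) x.1 (Sum.inl q.1, q.2)) ⬝ᵥ
    ((Tᵀ * pinv (T * diagonal (scaledVariance x) * T) * T) *ᵥ
      fun q => kronVec (Matrix.of x.2.1.2.1) x.1 (Sum.inl q.1, q.2))

/-- The nuisance quantities of a sample. -/
noncomputable def nuisance (N : ℕ) (n : Fin a → ℕ) (z : Fin a → ℕ → Fin c → ℝ)
    (e : Fin a → ℕ → Fin p → ℝ) : Nuisance a p c :=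
  (((√(N : ℝ))⁻¹, fun q q' => (scaledGram N n z)⁻¹ q q', fun i => (N : ℝ) / ((n i : ℝ) - c - 1),
    crossAverage n z), (errorSqAverage n e, errorFeatureAverage n z e))

/-- The scaled score `N^{-1/2} X̃' e`. -/
noncomputable def scaledScore (N : ℕ) (n : Fin a → ℕ) (z : Fin a → ℕ → Fin c → ℝ)
    (e : Fin a → ℕ → Fin p → ℝ) : EuclideanSpace ℝ ((Fin a ⊕ Fin c) × Fin p) :=
  WithLp.toLp 2 fun q => (√(N : ℝ))⁻¹ * score n z e q

/-- The null hypothesis removes `β` from `T μ̂`, and the residuals depend on `β` only through the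
estimation error. What remains is the score, rescaled. -/
theorem mancats_modelOutcome {N : ℕ} (hN : N ≠ 0) {n : Fin a → ℕ}
    {z : Fin a → ℕ → Fin c → ℝ} (hdet : IsUnit (scaledGram N n z).det)
    {β : (Fin a ⊕ Fin c) × Fin p → ℝ} {T : Matrix (Fin a × Fin p) (Fin a × Fin p) ℝ}
    (hT : T *ᵥ (fun q => β (Sum.inl q.1, q.2)) = 0) (e : Fin a → ℕ → Fin p → ℝ) :
    mancats n z T (modelOutcome z β e) =
      studentizedForm T (scaledScore N n z e, nuisance N n z e) := by
  have hN' : (N : ℝ) ≠ 0 := Nat.cast_ne_zero.mpr hN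
  set x : EuclideanSpace ℝ ((Fin a ⊕ Fin c) × Fin p) × Nuisance a p c :=
    (scaledScore N n z e, nuisance N n z e) with hx
  set u : (Fin a ⊕ Fin c) × Fin p → ℝ := kronVec (Matrix.of x.2.1.2.1) x.1 with hu
  have hols : ∀ q, olsEstimator n z (modelOutcome z β e) q = β q + (√(N : ℝ))⁻¹ * u q :=
    fun q => olsEstimator_modelOutcome hN hdet β e q
  have hD : DHat n z (modelOutcome z β e) = (N : ℝ)⁻¹ • diagonal (scaledVariance x) := by
    rw [DHat, ← diagonal_smul]
    congr 1
    funext q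
    have havg := average_sq_sub_linear (n q.1) (fun j => e q.1 j q.2) (fun j => feature z q.1 j)
      (fun w => (√(N : ℝ))⁻¹ * u (w, q.2))
    simp only [sigmaHatSq, residual_modelOutcome hols, Pi.smul_apply, smul_eq_mul]
    rw [← Finset.sum_range fun j =>
      (e q.1 j q.2 - ∑ w, feature z q.1 j w * ((√(N : ℝ))⁻¹ * u (w, q.2))) ^ 2]
    have hM : scaledVariance x q = (N : ℝ) / ((n q.1 : ℝ) - c - 1) * (1 / (n q.1 : ℝ) *
        ∑ j ∈ Finset.range (n q.1),
          (e q.1 j q.2 - ∑ w, feature z q.1 j w * ((√(N : ℝ))⁻¹ * u (w, q.2))) ^ 2) := by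
      rw [havg]
      rfl
    rw [hM]
    field_simp
  have hmu : T *ᵥ muHat n z (modelOutcome z β e) =
      (√(N : ℝ))⁻¹ • T *ᵥ (fun q => u (Sum.inl q.1, q.2)) := by
    have : muHat n z (modelOutcome z β e) = (fun q => β (Sum.inl q.1, q.2)) +
        (√(N : ℝ))⁻¹ • fun q : Fin a × Fin p => u (Sum.inl q.1, q.2) := by
      funext q
      exact hols _
    rw [this, Matrix.mulVec_add, hT, zero_add, Matrix.mulVec_smul]
  have hquad : ∀ (v : Fin a × Fin p → ℝ) (B : Matrix (Fin a × Fin p) (Fin a × Fin p) ℝ),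
      v ⬝ᵥ ((Tᵀ * B * T) *ᵥ v) = (T *ᵥ v) ⬝ᵥ (B *ᵥ (T *ᵥ v)) := by
    intro v B
    rw [← Matrix.mulVec_mulVec, ← Matrix.mulVec_mulVec, Matrix.dotProduct_mulVec,
      Matrix.vecMul_transpose]
  -- Two factors `N^{-1/2}` come from the two copies of `T μ̂`, the factor `N` from the
  -- pseudoinverse of `N⁻¹ • (…)`.
  have hs : (√(N : ℝ))⁻¹ * ((√(N : ℝ))⁻¹ * N) = 1 := by
    rw [← mul_assoc, ← mul_inv, Real.mul_self_sqrt (Nat.cast_nonneg N), inv_mul_cancel₀ hN']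
  rw [mancats, studentizedForm, hquad, hquad, hmu, hD, Matrix.mul_smul, Matrix.smul_mul,
    pinv_smul (inv_ne_zero hN'), inv_inv, Matrix.smul_mulVec, Matrix.mulVec_smul,
    smul_dotProduct, dotProduct_smul, dotProduct_smul, smul_eq_mul, smul_eq_mul, smul_eq_mul]
  rw [show ∀ b : ℝ, (√(N : ℝ))⁻¹ * (N * ((√(N : ℝ))⁻¹ * b)) =
    (√(N : ℝ))⁻¹ * ((√(N : ℝ))⁻¹ * N) * b from fun b => by ring, hs, one_mul]

theorem continuous_kronVec (q : (Fin a ⊕ Fin c) × Fin p) :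
    Continuous fun x : EuclideanSpace ℝ ((Fin a ⊕ Fin c) × Fin p) × Nuisance a p c =>
      kronVec (Matrix.of x.2.1.2.1) x.1 q := by
  unfold kronVec
  simp only [Matrix.of_apply]
  fun_prop

theorem continuous_scaledVariance :
    Continuous (scaledVariance :
      EuclideanSpace ℝ ((Fin a ⊕ Fin c) × Fin p) × Nuisance a p c → Fin a × Fin p → ℝ) := by
  have h := continuous_kronVec (a := a) (p := p) (c := c)
  refine continuous_pi fun q => ?_
  unfold scaledVariance
  fun_prop

theorem measurable_studentizedForm (T : Matrix (Fin a × Fin p) (Fin a × Fin p) ℝ) :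
    Measurable (studentizedForm (c := c) T) := by
  have hM : ∀ i j, Measurable fun x : EuclideanSpace ℝ ((Fin a ⊕ Fin c) × Fin p) ×
      Nuisance a p c => (diagonal (scaledVariance x) : Matrix _ _ ℝ) i j := by
    intro i j
    simp only [Matrix.diagonal_apply]
    split_ifs
    · exact ((continuous_apply i).comp continuous_scaledVariance).measurable
    · exact measurable_const
  have hP := fun i j => measurable_pinv_entry (measurable_mul_entry
    (measurable_mul_entry (fun i j => measurable_const (a := T i j)) hM)
      (fun i j => measurable_const (a := T i j))) i j
  have hW := fun i j => measurable_mul_entry (measurable_mul_entry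
    (fun i j => measurable_const (a := Tᵀ i j)) hP) (fun i j => measurable_const (a := T i j)) i j
  unfold studentizedForm
  simp only [dotProduct, Matrix.mulVec]
  refine Finset.measurable_fun_sum _ fun i _ => (continuous_kronVec _).measurable.mul ?_
  exact Finset.measurable_fun_sum _ fun j _ => (hW i j).mul (continuous_kronVec _).measurable

theorem continuousAt_quadraticForm {X d : Type*} [TopologicalSpace X] [Fintype d]
    {T : Matrix d d ℝ} {u : X → d → ℝ} {F : X → Matrix d d ℝ} {x : X} (hu : ContinuousAt u x)
    (hF : ContinuousAt F x) :
    ContinuousAt (fun x => u x ⬝ᵥ ((Tᵀ * F x * T) *ᵥ u x)) x := by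
  have h : Continuous fun y : (d → ℝ) × Matrix d d ℝ => y.1 ⬝ᵥ ((Tᵀ * y.2 * T) *ᵥ y.1) := by
    fun_prop
  exact ContinuousAt.comp (f := fun x => (u x, F x)) h.continuousAt (hu.prodMk hF)

theorem continuousAt_studentizedForm {T : Matrix (Fin a × Fin p) (Fin a × Fin p) ℝ}
    (hT : Tᵀ = T) (hTT : T * T = T)
    {x : EuclideanSpace ℝ ((Fin a ⊕ Fin c) × Fin p) × Nuisance a p c}
    (hx : ∀ q, 0 < scaledVariance x q) : ContinuousAt (studentizedForm T) x := by
  have h1 : ContinuousAt (fun x : EuclideanSpace ℝ ((Fin a ⊕ Fin c) × Fin p) × Nuisance a p c =>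
      pinv (T * diagonal (scaledVariance x) * T)) x :=
    ContinuousAt.comp (f := scaledVariance) (continuousAt_pinv_projector_diagonal hT hTT hx)
      continuous_scaledVariance.continuousAt
  have h2 : Continuous fun x : EuclideanSpace ℝ ((Fin a ⊕ Fin c) × Fin p) × Nuisance a p c =>
      fun q : Fin a × Fin p => kronVec (Matrix.of x.2.1.2.1) x.1 (Sum.inl q.1, q.2) :=
    continuous_pi fun q => continuous_kronVec _
  exact continuousAt_quadraticForm h2.continuousAt h1

/-- Convergence in distribution demands measurability for every `N`, including those for which the
representation by `studentizedForm` is not available. -/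
theorem measurable_mancats (n : Fin a → ℕ) (z : Fin a → ℕ → Fin c → ℝ)
    (T : Matrix (Fin a × Fin p) (Fin a × Fin p) ℝ) : Measurable (mancats n z T) := by
  have hev : ∀ i j k, Measurable fun y : Fin a → ℕ → Fin p → ℝ => y i j k := fun i j k => by
    fun_prop
  have hols : ∀ q, Measurable fun y : Fin a → ℕ → Fin p → ℝ => olsEstimator n z y q := by
    intro q
    simp only [olsEstimator, Matrix.mulVec, dotProduct, outcomeVector]
    exact Finset.measurable_fun_sum _ fun s _ => (hev _ _ _).const_mul _
  have hmu : ∀ q, Measurable fun y : Fin a → ℕ → Fin p → ℝ => muHat n z y q := fun q => hols _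
  have hD : ∀ i j, Measurable fun y : Fin a → ℕ → Fin p → ℝ => DHat n z y i j := by
    intro i j
    simp only [DHat, Matrix.diagonal_apply]
    split_ifs
    · refine Measurable.const_mul (Measurable.const_mul ?_ _) _
      refine Finset.measurable_fun_sum _ fun l _ => Measurable.pow_const ?_ 2
      refine ((hev _ _ _).sub (hmu _)).sub ?_
      exact Finset.measurable_fun_sum _ fun w _ => (hols _).const_mul _
    · exact measurable_const
  have hP := fun i j => measurable_pinv_entry (measurable_mul_entry
    (measurable_mul_entry (fun i j => measurable_const (a := T i j)) hD)
      (fun i j => measurable_const (a := T i j))) i j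
  have hW := fun i j => measurable_mul_entry (measurable_mul_entry
    (fun i j => measurable_const (a := Tᵀ i j)) hP) (fun i j => measurable_const (a := T i j)) i j
  unfold mancats
  simp only [dotProduct, Matrix.mulVec]
  refine Finset.measurable_fun_sum _ fun i _ => (hmu i).mul ?_
  exact Finset.measurable_fun_sum _ fun j _ => (hW i j).mul (hmu j)

end Studentization

/-! ### Linear images and quadratic forms of Gaussian vectors. -/

section GaussianForms

/-- The image of a centered Gaussian vector under a linear map. -/
theorem map_mulVec_multivariateGaussian {m d : Type*} [Fintype m] [DecidableEq m] [Fintype d]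
    [DecidableEq d] {V : Matrix m m ℝ} (hV : V.PosSemidef) (A : Matrix d m ℝ) :
    (multivariateGaussian 0 V).map
        (fun x : EuclideanSpace ℝ m => (WithLp.toLp 2 (A *ᵥ x) : EuclideanSpace ℝ d)) =
      multivariateGaussian 0 (A * V * Aᵀ) := by
  have hAV : (A * V * Aᵀ).PosSemidef := by
    simpa using hV.mul_mul_conjTranspose_same A
  have hm : Measurable
      (fun x : EuclideanSpace ℝ m => (WithLp.toLp 2 (A *ᵥ x) : EuclideanSpace ℝ d)) := by
    have : Continuous
      (fun x : EuclideanSpace ℝ m => (WithLp.toLp 2 (A *ᵥ x) : EuclideanSpace ℝ d)) := by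
      fun_prop
    exact this.measurable
  have := Measure.isProbabilityMeasure_map (μ := multivariateGaussian (0 : EuclideanSpace ℝ m) V)
    hm.aemeasurable
  refine Measure.ext_of_charFun ?_
  ext t
  have hin : ∀ x : EuclideanSpace ℝ m,
      inner ℝ (WithLp.toLp 2 (A *ᵥ x) : EuclideanSpace ℝ d) t =
        inner ℝ x (WithLp.toLp 2 (Aᵀ *ᵥ t) : EuclideanSpace ℝ m) := by
    intro x
    simp only [EuclideanSpace.inner_eq_star_dotProduct, star_trivial]
    rw [Matrix.mulVec_transpose, ← Matrix.dotProduct_mulVec]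
  rw [charFun_apply, integral_map hm.aemeasurable (by fun_prop)]
  simp only [hin]
  rw [← charFun_apply, charFun_multivariateGaussian hV, charFun_multivariateGaussian hAV]
  simp only [inner_zero_right]
  congr 3
  rw [Matrix.mulVec_transpose, ← Matrix.dotProduct_mulVec, ← Matrix.mulVec_transpose,
    Matrix.mulVec_mulVec, Matrix.mulVec_mulVec, Matrix.mul_assoc]

/-- A quadratic form in a centered Gaussian vector has the law of a weighted sum of independent
`χ²₁` variables. -/
theorem map_quadraticForm_multivariateGaussian {d : Type*} [Fintype d] [DecidableEq d]
    {V W A : Matrix d d ℝ} {lam : d → ℝ} (hV : V = A * Aᵀ) (hA : Aᵀ * W * A = diagonal lam)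
    {Ω' : Type*} [MeasurableSpace Ω'] {P' : Measure Ω'} {U : d → Ω' → ℝ}
    (hU : iIndepFun U P') (hlaw : ∀ q, HasLaw (U q) chiSqOne P') :
    (multivariateGaussian 0 V).map (fun x : EuclideanSpace ℝ d => x ⬝ᵥ W *ᵥ x) =
      P'.map fun ω => ∑ q, lam q * U q ω := by
  have hP' := hU.isProbabilityMeasure
  have hm : Measurable
      (fun x : EuclideanSpace ℝ d => (WithLp.toLp 2 (A *ᵥ x) : EuclideanSpace ℝ d)) := by
    have : Continuous
      (fun x : EuclideanSpace ℝ d => (WithLp.toLp 2 (A *ᵥ x) : EuclideanSpace ℝ d)) := by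
      fun_prop
    exact this.measurable
  have hq : Measurable (fun x : EuclideanSpace ℝ d => x ⬝ᵥ W *ᵥ x) := by
    have : Continuous (fun x : EuclideanSpace ℝ d => x ⬝ᵥ W *ᵥ x) := by fun_prop
    exact this.measurable
  have hform : ∀ g : d → ℝ, (A *ᵥ g) ⬝ᵥ (W *ᵥ (A *ᵥ g)) = ∑ q, lam q * g q ^ 2 := by
    intro g
    have : (A *ᵥ g) ⬝ᵥ (W *ᵥ (A *ᵥ g)) = g ⬝ᵥ (diagonal lam *ᵥ g) := by
      rw [← hA, ← Matrix.mulVec_mulVec, ← Matrix.mulVec_mulVec, Matrix.dotProduct_mulVec g,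
        Matrix.vecMul_transpose]
    rw [this, dotProduct]
    exact Finset.sum_congr rfl fun q _ => by rw [Matrix.mulVec_diagonal]; ring
  have hV1 : V = A * 1 * Aᵀ := by rw [Matrix.mul_one, hV]
  rw [hV1, ← map_mulVec_multivariateGaussian Matrix.PosSemidef.one A, Measure.map_map hq hm,
    multivariateGaussian_zero_one, ← map_pi_eq_stdGaussian,
    Measure.map_map (hq.comp hm) (by fun_prop)]
  have hsum : Measurable fun u : d → ℝ => ∑ q, lam q * u q := by fun_prop
  -- Independence determines the joint law of the `U q`, so squared coordinates of a standard
  -- Gaussian vector may stand in for them.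
  have hjoint : P'.map (fun ω q => U q ω) =
      (Measure.pi fun _ : d => gaussianReal 0 1).map (fun g q => g q ^ 2) := by
    rw [(iIndepFun_iff_map_fun_eq_pi_map fun q => (hlaw q).aemeasurable).mp hU,
      Measure.pi_map_pi (μ := fun _ : d => gaussianReal 0 1) (f := fun _ : d => fun g : ℝ => g ^ 2)
        fun _ => by fun_prop]
    congr 1
    funext q
    exact (hlaw q).map_eq
  have hUm : AEMeasurable (fun ω q => U q ω) P' :=
    aemeasurable_pi_lambda _ fun q => (hlaw q).aemeasurable
  calc _ = (Measure.pi fun _ : d => gaussianReal 0 1).map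
        ((fun u : d → ℝ => ∑ q, lam q * u q) ∘ fun g q => g q ^ 2) := by
        congr 1
        funext g
        exact hform g
    _ = (P'.map (fun ω q => U q ω)).map (fun u : d → ℝ => ∑ q, lam q * u q) := by
        rw [hjoint, Measure.map_map hsum (by fun_prop)]
    _ = _ := by
        rw [AEMeasurable.map_map_of_aemeasurable hsum.aemeasurable hUm]
        rfl

end GaussianForms


/-! ### Convergence in probability of tuples. -/

section ConvergenceInMeasure

variable {Ω : Type*} [MeasurableSpace Ω] {P : Measure Ω}

theorem tendstoInMeasure_of_tendsto {E : Type*} [PseudoEMetricSpace E] {d : ℕ → E} {l : E}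
    (h : Tendsto d atTop (𝓝 l)) : TendstoInMeasure P (fun N _ => d N) atTop (fun _ => l) := by
  intro δ hδ
  refine tendsto_const_nhds.congr' ?_
  have := (EMetric.tendsto_nhds.mp h) δ hδ
  filter_upwards [this] with N hN
  simp [not_le.mpr hN]

theorem tendstoInMeasure_prodMk {E F : Type*} [PseudoEMetricSpace E] [PseudoEMetricSpace F]
    {f : ℕ → Ω → E} {g : ℕ → Ω → F} {l : E} {l' : F}
    (hf : TendstoInMeasure P f atTop fun _ => l) (hg : TendstoInMeasure P g atTop fun _ => l') :
    TendstoInMeasure P (fun N ω => (f N ω, g N ω)) atTop fun _ => (l, l') := by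
  intro δ hδ
  have := (hf δ hδ).add (hg δ hδ)
  rw [add_zero] at this
  refine tendsto_of_tendsto_of_tendsto_of_le_of_le tendsto_const_nhds this
    (fun _ => bot_le) fun N => ?_
  refine le_trans (measure_mono fun ω hω => ?_) (measure_union_le _ _)
  simpa [Prod.edist_eq] using hω

theorem tendstoInMeasure_pi {ι : Type*} [Fintype ι] {E : ι → Type*}
    [∀ i, PseudoEMetricSpace (E i)] {f : ℕ → Ω → ∀ i, E i} {l : ∀ i, E i}
    (hf : ∀ i, TendstoInMeasure P (fun N ω => f N ω i) atTop fun _ => l i) :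
    TendstoInMeasure P f atTop fun _ => l := by
  intro δ hδ
  have := tendsto_finsetSum (Finset.univ : Finset ι) fun i _ => hf i δ hδ
  rw [Finset.sum_const_zero] at this
  refine tendsto_of_tendsto_of_tendsto_of_le_of_le tendsto_const_nhds this
    (fun _ => bot_le) fun N => ?_
  refine le_trans (measure_mono fun ω hω => ?_) (measure_biUnion_finset_le _ _)
  simp only [Set.mem_ofPred_eq, Set.mem_iUnion, Finset.mem_univ, exists_prop, true_and] at hω ⊢
  by_contra! hcon
  refine absurd hω (not_le.mpr ?_)
  rw [edist_pi_def, Finset.sup_lt_iff hδ]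
  exact fun i _ => hcon i

end ConvergenceInMeasure

/-! ### Sums of uniformly small weights. -/

section SmallSums

/-- Uniformly small weights make all `φ (w N s)` small at once, while the total weight stays
bounded. With `φ` the identity and the square root this yields the two negligibility conditions of
the central limit theorem. -/
theorem tendsto_sum_mul_comp {ι : ℕ → Type*} [∀ N, Fintype (ι N)] {w : ∀ N, ι N → ℝ}
    (hw : ∀ N s, 0 ≤ w N s) {l : ℝ} (hl : Tendsto (fun N => ∑ s, w N s) atTop (𝓝 l))
    (hsmall : ∀ δ > 0, ∀ᶠ N in atTop, ∀ s, w N s ≤ δ) {φ : ℝ → ℝ} (hφ : ContinuousAt φ 0)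
    (hφ0 : φ 0 = 0) : Tendsto (fun N => ∑ s, w N s * φ (w N s)) atTop (𝓝 0) := by
  rw [Metric.tendsto_nhds]
  intro η hη
  have hL : 0 < |l| + 1 := by positivity
  obtain ⟨δ, hδ, hδφ⟩ := Metric.continuousAt_iff.mp hφ (η / (2 * (|l| + 1))) (by positivity)
  filter_upwards [hsmall (δ / 2) (by positivity),
    hl.eventually (gt_mem_nhds (lt_of_le_of_lt (le_abs_self l) (lt_add_one _)))] with N h1 h2
  rw [Real.dist_eq, sub_zero]
  have hb : ∀ s, |w N s * φ (w N s)| ≤ w N s * (η / (2 * (|l| + 1))) := by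
    intro s
    rw [abs_mul, abs_of_nonneg (hw N s)]
    refine mul_le_mul_of_nonneg_left ?_ (hw N s)
    have := hδφ (x := w N s) (by
      rw [Real.dist_eq, sub_zero, abs_of_nonneg (hw N s)]
      linarith [h1 s])
    rw [hφ0, Real.dist_eq, sub_zero] at this
    exact this.le
  calc |∑ s, w N s * φ (w N s)| ≤ ∑ s, |w N s * φ (w N s)| := Finset.abs_sum_le_sum_abs _ _
    _ ≤ ∑ s, w N s * (η / (2 * (|l| + 1))) := Finset.sum_le_sum fun s _ => hb s
    _ = (∑ s, w N s) * (η / (2 * (|l| + 1))) := by rw [Finset.sum_mul]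
    _ ≤ (|l| + 1) * (η / (2 * (|l| + 1))) := by gcongr
    _ = η / 2 := by field_simp
    _ < η := by linarith

end SmallSums

/-! ### Moments of the errors and laws of large numbers for their averages. -/

section Errors

variable {a p c : ℕ} {Ω : Type*} [MeasurableSpace Ω] {P : Measure Ω}
  {ε : Fin a → ℕ → Ω → Fin p → ℝ}

variable [IsProbabilityMeasure P]

theorem integral_mul_error {S : Fin a → Matrix (Fin p) (Fin p) ℝ}
    (hLp : ∀ i j k, MemLp (fun ω => ε i j ω k) 4 P) (hmean : ∀ i j k, ∫ ω, ε i j ω k ∂P = 0)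
    (hcov : ∀ i j k l, cov[fun ω => ε i j ω k, fun ω => ε i j ω l; P] = S i k l)
    (i : Fin a) (j : ℕ) (k l : Fin p) : ∫ ω, ε i j ω k * ε i j ω l ∂P = S i k l := by
  have h2 : ∀ k, MemLp (fun ω => ε i j ω k) 2 P := fun k => (hLp i j k).mono_exponent (by norm_num)
  have := covariance_eq_sub (h2 k) (h2 l)
  rw [hcov, hmean, zero_mul, sub_zero] at this
  exact this.symm

theorem integral_sq_linear_error {S : Fin a → Matrix (Fin p) (Fin p) ℝ}
    (hLp : ∀ i j k, MemLp (fun ω => ε i j ω k) 4 P) (hmean : ∀ i j k, ∫ ω, ε i j ω k ∂P = 0)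
    (hcov : ∀ i j k l, cov[fun ω => ε i j ω k, fun ω => ε i j ω l; P] = S i k l)
    (i : Fin a) (j : ℕ) (b : Fin p → ℝ) :
    ∫ ω, (∑ k, b k * ε i j ω k) ^ 2 ∂P = b ⬝ᵥ (S i *ᵥ b) := by
  have h2 : ∀ k, MemLp (fun ω => ε i j ω k) 2 P := fun k => (hLp i j k).mono_exponent (by norm_num)
  have hint : ∀ k l, Integrable (fun ω => b k * b l * (ε i j ω k * ε i j ω l)) P :=
    fun k l => ((h2 k).integrable_mul (h2 l)).const_mul _
  have e : ∀ ω, (∑ k, b k * ε i j ω k) ^ 2 =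
      ∑ k, ∑ l, b k * b l * (ε i j ω k * ε i j ω l) := by
    intro ω
    rw [sq, Finset.sum_mul_sum]
    exact Finset.sum_congr rfl fun k _ => Finset.sum_congr rfl fun l _ => by ring
  simp only [e]
  rw [integral_finsetSum _ fun k _ => integrable_finsetSum _ fun l _ => hint k l]
  rw [dotProduct]
  refine Finset.sum_congr rfl fun k _ => ?_
  rw [integral_finsetSum _ fun l _ => hint k l, Matrix.mulVec, dotProduct, Finset.mul_sum]
  refine Finset.sum_congr rfl fun l _ => ?_
  rw [integral_const_mul, integral_mul_error hLp hmean hcov]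
  ring

/-- Uniform bounds for the second and third moments of the sums of absolute errors. -/
theorem exists_moment_bound {C₁ : ℝ} (hLp : ∀ i j k, MemLp (fun ω => ε i j ω k) 4 P)
    (hfourth : ∀ i j k, ∫ ω, ε i j ω k ^ 4 ∂P ≤ C₁) :
    ∃ M : ℝ, ∀ i j, MemLp (fun ω => ∑ k, |ε i j ω k|) 4 P ∧
      ∫ ω, (∑ k, |ε i j ω k|) ^ 2 ∂P ≤ M ∧ ∫ ω, (∑ k, |ε i j ω k|) ^ 3 ∂P ≤ M := by
  -- The power mean inequality bounds the fourth moment of the sum of `p` terms by `p³ · pC₁`; lower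
  -- moments follow from `x ^ m ≤ 1 + x ^ 4` for `x ≥ 0` and `m ≤ 4`.
  refine ⟨1 + (p : ℝ) ^ 3 * (p * C₁), fun i j => ?_⟩
  have hL : MemLp (fun ω => ∑ k, |ε i j ω k|) 4 P :=
    memLp_finsetSum _ fun k _ => (hLp i j k).norm
  have h0 : ∀ ω, 0 ≤ ∑ k, |ε i j ω k| := fun ω => Finset.sum_nonneg fun k _ => abs_nonneg _
  have hint : ∀ m : ℕ, m ≠ 0 → m ≤ 4 → Integrable (fun ω => (∑ k, |ε i j ω k|) ^ m) P := by
    intro m hm hm4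
    have h1 : MemLp (fun ω => ∑ k, |ε i j ω k|) m P :=
      hL.mono_exponent (by exact_mod_cast hm4)
    refine (h1.integrable_norm_pow hm).congr (ae_of_all _ fun ω => ?_)
    simp only [Real.norm_eq_abs, abs_of_nonneg (h0 ω)]
  have hint4 : ∀ k, Integrable (fun ω => ε i j ω k ^ 4) P := by
    intro k
    refine ((hLp i j k).integrable_norm_pow (p := 4) (by norm_num)).congr
      (ae_of_all _ fun ω => ?_)
    simp only [Real.norm_eq_abs]
    exact Even.pow_abs (by decide) _
  have h4 : ∫ ω, (∑ k, |ε i j ω k|) ^ 4 ∂P ≤ (p : ℝ) ^ 3 * (p * C₁) := by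
    have hpt : ∀ ω, (∑ k, |ε i j ω k|) ^ 4 ≤ (p : ℝ) ^ 3 * ∑ k, ε i j ω k ^ 4 := by
      intro ω
      have h := pow_sum_div_card_le_sum_pow (s := Finset.univ) (f := fun k => |ε i j ω k|)
        (fun k _ => abs_nonneg _) 3
      simp only [Finset.card_univ, Fintype.card_fin] at h
      have e4 : ∀ k, |ε i j ω k| ^ (3 + 1) = ε i j ω k ^ 4 := fun k => Even.pow_abs (by decide) _
      simp only [e4] at h
      rcases Nat.eq_zero_or_pos p with hp | hp
      · subst hp; simp
      · have hp3 : (0 : ℝ) < (p : ℝ) ^ 3 := by positivity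
        rw [div_le_iff₀ hp3] at h
        rw [mul_comm]
        exact h
    calc ∫ ω, (∑ k, |ε i j ω k|) ^ 4 ∂P ≤ ∫ ω, (p : ℝ) ^ 3 * ∑ k, ε i j ω k ^ 4 ∂P :=
          integral_mono (hint 4 (by norm_num) le_rfl)
            ((integrable_finsetSum _ fun k _ => hint4 k).const_mul _) hpt
      _ = (p : ℝ) ^ 3 * ∑ k, ∫ ω, ε i j ω k ^ 4 ∂P := by
          rw [integral_const_mul, integral_finsetSum _ fun k _ => hint4 k]
      _ ≤ (p : ℝ) ^ 3 * ∑ _k : Fin p, C₁ := by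
          gcongr with k
          exact hfourth i j k
      _ = _ := by simp
  have hm : ∀ m : ℕ, m ≠ 0 → m ≤ 4 →
      ∫ ω, (∑ k, |ε i j ω k|) ^ m ∂P ≤ 1 + (p : ℝ) ^ 3 * (p * C₁) := by
    intro m hm0 hm4
    calc ∫ ω, (∑ k, |ε i j ω k|) ^ m ∂P ≤ ∫ ω, (1 + (∑ k, |ε i j ω k|) ^ 4) ∂P := by
          refine integral_mono (hint m hm0 hm4)
            ((integrable_const _).add (hint 4 (by norm_num) le_rfl)) fun ω => ?_
          rcases le_total (∑ k, |ε i j ω k|) 1 with h | h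
          · have := pow_le_one₀ (n := m) (h0 ω) h
            have := pow_nonneg (h0 ω) 4
            simp only
            linarith
          · have := pow_le_pow_right₀ h hm4
            simp only
            linarith
      _ = 1 + ∫ ω, (∑ k, |ε i j ω k|) ^ 4 ∂P := by
          rw [integral_add (integrable_const _) (hint 4 (by norm_num) le_rfl)]
          simp
      _ ≤ _ := by linarith
  exact ⟨hL, hm 2 (by norm_num) (by norm_num), hm 3 (by norm_num) (by norm_num)⟩

variable {n : ℕ → Fin a → ℕ} {z : Fin a → ℕ → Fin c → ℝ} {κ : Fin a → ℝ}
  {C : Fin a → Fin a ⊕ Fin c → Fin a ⊕ Fin c → ℝ}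

/-- Here fourth moments enter: they bound the variances of the squared errors by `C₁`, so the
variance of the average is at most `C₁ / nᵢ`. -/
theorem tendstoInMeasure_errorSqAverage {S : Fin a → Matrix (Fin p) (Fin p) ℝ} {C₁ : ℝ}
    (hindep : iIndepFun (fun q : Fin a × ℕ => ε q.1 q.2) P)
    (hLp : ∀ i j k, MemLp (fun ω => ε i j ω k) 4 P) (hmean : ∀ i j k, ∫ ω, ε i j ω k ∂P = 0)
    (hcov : ∀ i j k l, cov[fun ω => ε i j ω k, fun ω => ε i j ω l; P] = S i k l)
    (hfourth : ∀ i j k, ∫ ω, ε i j ω k ^ 4 ∂P ≤ C₁)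
    (hn : ∀ i, Tendsto (fun N => (n N i : ℝ)) atTop atTop) (q : Fin a × Fin p) :
    TendstoInMeasure P (fun N ω => errorSqAverage (n N) (fun i j => ε i j ω) q) atTop
      fun _ => S q.1 q.2 q.2 := by
  obtain ⟨i, k⟩ := q
  have hint4 : ∀ j, Integrable (fun ω => (ε i j ω k ^ 2) ^ 2) P := by
    intro j
    refine ((hLp i j k).integrable_norm_pow (p := 4) (by norm_num)).congr
      (ae_of_all _ fun ω => ?_)
    simp only [Real.norm_eq_abs]
    rw [Even.pow_abs (by decide)]
    ring
  have hmeas : ∀ j, AEStronglyMeasurable (fun ω => ε i j ω k ^ 2) P :=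
    fun j => (hLp i j k).aestronglyMeasurable.pow 2
  refine tendstoInMeasure_average (ζ := fun j ω => ε i j ω k ^ 2) (e := fun _ => S i k k)
    (B := fun _ => C₁) (m := fun N => n N i) ?_ ?_ ?_ ?_ ?_ ?_
  · intro j j' hj
    have h := hindep.indepFun (i := (i, j)) (j := (i, j')) (by simpa using hj)
    exact h.comp (φ := fun v : Fin p → ℝ => v k ^ 2) (ψ := fun v : Fin p → ℝ => v k ^ 2)
      (by fun_prop) (by fun_prop)
  · exact fun j => (memLp_two_iff_integrable_sq (hmeas j)).mpr (hint4 j)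
  · intro j
    rw [← integral_mul_error hLp hmean hcov i j k k]
    simp only [sq]
  · intro j
    refine (variance_le_expectation_sq (hmeas j)).trans (le_trans (le_of_eq ?_) (hfourth i j k))
    refine integral_congr_ae (ae_of_all _ fun ω => ?_)
    simp only [Pi.pow_apply]
    ring
  · refine tendsto_const_nhds.congr' ?_
    filter_upwards [(hn i).eventually_gt_atTop 0] with N hN
    simp only [Finset.sum_const, Finset.card_range, nsmul_eq_mul]
    field_simp
  · have h : Tendsto (fun N => C₁ / (n N i : ℝ)) atTop (𝓝 0) := (hn i).const_div_atTop C₁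
    refine h.congr' ?_
    filter_upwards [(hn i).eventually_gt_atTop 0] with N hN
    simp only [Finset.sum_const, Finset.card_range, nsmul_eq_mul]
    field_simp

/-- The average has mean zero, and its variance is at most a convergent average of squared features
times `σ²_{ik} / nᵢ`. -/
theorem tendstoInMeasure_errorFeatureAverage {S : Fin a → Matrix (Fin p) (Fin p) ℝ}
    (hindep : iIndepFun (fun q : Fin a × ℕ => ε q.1 q.2) P)
    (hLp : ∀ i j k, MemLp (fun ω => ε i j ω k) 4 P) (hmean : ∀ i j k, ∫ ω, ε i j ω k ∂P = 0)
    (hcov : ∀ i j k l, cov[fun ω => ε i j ω k, fun ω => ε i j ω l; P] = S i k l)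
    (hn : ∀ i, Tendsto (fun N => (n N i : ℝ)) atTop atTop)
    (hC : ∀ i q q', Tendsto (fun N => crossAverage (n N) z i q q') atTop (𝓝 (C i q q')))
    (q : Fin a × (Fin a ⊕ Fin c) × Fin p) :
    TendstoInMeasure P (fun N ω => errorFeatureAverage (n N) z (fun i j => ε i j ω) q) atTop
      fun _ => 0 := by
  obtain ⟨i, w, k⟩ := q
  have h2 : ∀ j, MemLp (fun ω => ε i j ω k) 2 P := fun j => (hLp i j k).mono_exponent (by norm_num)
  refine tendstoInMeasure_average (ζ := fun j ω => feature z i j w * ε i j ω k) (e := fun _ => 0)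
    (B := fun j => feature z i j w * feature z i j w * S i k k) (m := fun N => n N i)
    ?_ ?_ ?_ ?_ ?_ ?_
  · intro j j' hj
    have h := hindep.indepFun (i := (i, j)) (j := (i, j')) (by simpa using hj)
    exact h.comp (φ := fun v : Fin p → ℝ => feature z i j w * v k)
      (ψ := fun v : Fin p → ℝ => feature z i j' w * v k) (by fun_prop) (by fun_prop)
  · exact fun j => (h2 j).const_mul _
  · intro j
    rw [integral_const_mul, hmean, mul_zero]
  · intro j
    refine (variance_le_expectation_sq ((h2 j).const_mul _).aestronglyMeasurable).trans
      (le_of_eq ?_)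
    rw [← integral_mul_error hLp hmean hcov i j k k, ← integral_const_mul]
    refine integral_congr_ae (ae_of_all _ fun ω => ?_)
    simp only [Pi.pow_apply]
    ring
  · simp
  · have h : Tendsto (fun N => crossAverage (n N) z i w w * S i k k / (n N i : ℝ)) atTop (𝓝 0) :=
      ((hC i w w).mul_const _).div_atTop (hn i)
    refine h.congr fun N => ?_
    rw [← Finset.sum_mul, crossAverage]
    ring

end Errors


/-! ### Asymptotic normality of the scaled score. -/

section Score

variable {a p c : ℕ}

/-- The contribution weights of subject `j` of group `i` to the linear form `t` in the score. -/
def scoreWeight (z : Fin a → ℕ → Fin c → ℝ) (t : (Fin a ⊕ Fin c) × Fin p → ℝ) (i : Fin a) (j : ℕ)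
    (k : Fin p) : ℝ :=
  ∑ q, t (q, k) * feature z i j q

/-- Regrouping a linear form by subjects exhibits it as a sum of independent terms, as the
Cramér-Wold reduction requires. -/
theorem inner_scaledScore (N : ℕ) (n : Fin a → ℕ) (z : Fin a → ℕ → Fin c → ℝ)
    (e : Fin a → ℕ → Fin p → ℝ) (t : EuclideanSpace ℝ ((Fin a ⊕ Fin c) × Fin p)) :
    inner ℝ (scaledScore N n z e) t =
      ∑ s : Subj n, (√(N : ℝ))⁻¹ * ∑ k, scoreWeight z t s.1 s.2 k * e s.1 s.2 k := by
  rw [sum_subj (n := n) fun i j => (√(N : ℝ))⁻¹ * ∑ k, scoreWeight z t i j k * e i j k]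
  simp only [EuclideanSpace.inner_eq_star_dotProduct, star_trivial, dotProduct, scaledScore, score,
    scoreWeight, Fintype.sum_prod_type_right, Finset.sum_mul, Finset.mul_sum]
  rw [Finset.sum_congr rfl fun k _ => Finset.sum_comm, Finset.sum_comm]
  refine Finset.sum_congr rfl fun i _ => ?_
  rw [Finset.sum_congr rfl fun k _ => Finset.sum_comm, Finset.sum_comm]
  refine Finset.sum_congr rfl fun j _ => Finset.sum_congr rfl fun k _ =>
    Finset.sum_congr rfl fun q _ => by ring

theorem dotProduct_scaledMiddle_mulVec (N : ℕ) (n : Fin a → ℕ) (z : Fin a → ℕ → Fin c → ℝ)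
    (S : Fin a → Matrix (Fin p) (Fin p) ℝ) (t : (Fin a ⊕ Fin c) × Fin p → ℝ) :
    t ⬝ᵥ (scaledMiddle N n z S *ᵥ t) =
      ∑ s : Subj n, (N : ℝ)⁻¹ * (scoreWeight z t s.1 s.2 ⬝ᵥ (S s.1 *ᵥ scoreWeight z t s.1 s.2)) := by
  have hX : ∀ (s : Subj n) (k : Fin p),
      (bigDesignMatrix p n z *ᵥ t) (s, k) = scoreWeight z t s.1 s.2 k := by
    intro s k
    simp only [Matrix.mulVec, dotProduct, Fintype.sum_prod_type, bigDesignMatrix_apply, ite_mul,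
      zero_mul, Finset.sum_ite_eq, Finset.mem_univ, if_true, scoreWeight]
    exact Finset.sum_congr rfl fun q _ => mul_comm _ _
  have hC : ∀ (v : Subj n × Fin p → ℝ) (s : Subj n) (k : Fin p),
      (errorCov n S *ᵥ v) (s, k) = ∑ l, S s.1 k l * v (s, l) := by
    intro v s k
    simp only [Matrix.mulVec, dotProduct, Fintype.sum_prod_type, errorCov, Matrix.of_apply]
    rw [Finset.sum_eq_single s (fun t _ ht => by simp [ht.symm]) (by simp)]
    simp
  rw [scaledMiddle, Matrix.smul_mulVec, dotProduct_smul, smul_eq_mul, ← Matrix.mulVec_mulVec,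
    ← Matrix.mulVec_mulVec, Matrix.dotProduct_mulVec, Matrix.vecMul_transpose, dotProduct,
    Fintype.sum_prod_type, ← Finset.mul_sum]
  simp only [hX, hC]
  rfl

theorem sq_scoreWeight_le (z : Fin a → ℕ → Fin c → ℝ) (t : (Fin a ⊕ Fin c) × Fin p → ℝ)
    (i : Fin a) (j : ℕ) (k : Fin p) :
    scoreWeight z t i j k ^ 2 ≤ (∑ q, t q ^ 2) * ∑ q, feature z i j q ^ 2 := by
  refine (Finset.sum_mul_sq_le_sq_mul_sq _ _ _).trans ?_
  refine mul_le_mul_of_nonneg_right ?_ (Finset.sum_nonneg fun _ _ => sq_nonneg _)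
  rw [Fintype.sum_prod_type_right]
  exact Finset.single_le_sum (f := fun k => ∑ q, t (q, k) ^ 2)
    (fun _ _ => Finset.sum_nonneg fun _ _ => sq_nonneg _) (Finset.mem_univ k)

variable {Ω : Type*} [MeasurableSpace Ω] {P : Measure Ω}
  {ε : Fin a → ℕ → Ω → Fin p → ℝ} {n : ℕ → Fin a → ℕ} {z : Fin a → ℕ → Fin c → ℝ}
  {κ : Fin a → ℝ} {C : Fin a → Fin a ⊕ Fin c → Fin a ⊕ Fin c → ℝ}

theorem aemeasurable_scaledScore (hLp : ∀ i j k, MemLp (fun ω => ε i j ω k) 4 P) (N : ℕ)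
    (n : Fin a → ℕ) (z : Fin a → ℕ → Fin c → ℝ) :
    AEMeasurable (fun ω => scaledScore N n z fun i j => ε i j ω) P := by
  have h : ∀ i j k, AEMeasurable (fun ω => ε i j ω k) P :=
    fun i j k => (hLp i j k).aestronglyMeasurable.aemeasurable
  refine (WithLp.measurable_toLp 2 _).comp_aemeasurable (aemeasurable_pi_lambda _ fun q => ?_)
  refine AEMeasurable.const_mul ?_ _
  exact Finset.aemeasurable_fun_sum _ fun i _ => Finset.aemeasurable_fun_sum _ fun j _ =>
    (h i j q.2).const_mul _

/-- The scaled squared norm of the features of a subject. -/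
noncomputable def leverage (N : ℕ) (z : Fin a → ℕ → Fin c → ℝ) (i : Fin a) (j : ℕ) : ℝ :=
  (N : ℝ)⁻¹ * ∑ q, feature z i j q ^ 2

theorem leverage_nonneg (N : ℕ) (z : Fin a → ℕ → Fin c → ℝ) (i : Fin a) (j : ℕ) :
    0 ≤ leverage N z i j :=
  mul_nonneg (by positivity) (Finset.sum_nonneg fun _ _ => sq_nonneg _)

theorem tendsto_groupLeverage (hκ : ∀ i, 0 < κ i)
    (hκlim : ∀ i, Tendsto (fun N : ℕ => (N : ℝ) / (n N i : ℝ)) atTop (𝓝 (κ i)))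
    (hC : ∀ i q q', Tendsto (fun N => crossAverage (n N) z i q q') atTop (𝓝 (C i q q')))
    (i : Fin a) :
    Tendsto (fun N : ℕ => (N : ℝ)⁻¹ * ∑ j ∈ Finset.range (n N i), ∑ q, feature z i j q ^ 2) atTop
      (𝓝 ((κ i)⁻¹ * ∑ q, C i q q)) := by
  have h := (tendsto_groupFraction (hκ i) (hκlim i)).mul
    (tendsto_finsetSum Finset.univ fun q _ => hC i q q)
  refine h.congr fun N => ?_
  rw [inv_mul_sum_eq, Finset.sum_comm, Finset.mul_sum (a := 1 / (n N i : ℝ))]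
  simp only [crossAverage, sq]

theorem tendsto_sum_leverage (hκ : ∀ i, 0 < κ i)
    (hκlim : ∀ i, Tendsto (fun N : ℕ => (N : ℝ) / (n N i : ℝ)) atTop (𝓝 (κ i)))
    (hC : ∀ i q q', Tendsto (fun N => crossAverage (n N) z i q q') atTop (𝓝 (C i q q'))) :
    Tendsto (fun N => ∑ s : Subj (n N), leverage N z s.1 s.2) atTop
      (𝓝 (∑ i, (κ i)⁻¹ * ∑ q, C i q q)) := by
  refine (tendsto_finsetSum _ fun i _ => tendsto_groupLeverage hκ hκlim hC i).congr fun N => ?_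
  rw [sum_subj (n := n N) fun i j => leverage N z i j]
  simp only [leverage, Finset.mul_sum]

/-- No single subject dominates: convergence of the averaged squared features forces each of them to
be `o(N)`, uniformly over the sample. -/
theorem eventually_leverage_le (hκ : ∀ i, 0 < κ i)
    (hκlim : ∀ i, Tendsto (fun N : ℕ => (N : ℝ) / (n N i : ℝ)) atTop (𝓝 (κ i)))
    (hC : ∀ i q q', Tendsto (fun N => crossAverage (n N) z i q q') atTop (𝓝 (C i q q')))
    {δ : ℝ} (hδ : 0 < δ) : ∀ᶠ N in atTop, ∀ s : Subj (n N), leverage N z s.1 s.2 ≤ δ := by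
  have h : ∀ᶠ N : ℕ in atTop, ∀ i, ∀ j < n N i, ∑ q, feature z i j q ^ 2 ≤ δ * N := by
    rw [eventually_all]
    exact fun i => eventually_forall_le_mul_of_tendsto_average
      (fun j => Finset.sum_nonneg fun _ _ => sq_nonneg _) (tendsto_groupLeverage hκ hκlim hC i) hδ
  filter_upwards [h, eventually_gt_atTop 0] with N hN hN0 s
  have hpos : (0 : ℝ) < N := Nat.cast_pos.mpr hN0
  rw [leverage, inv_mul_le_iff₀ hpos, mul_comm]
  exact hN s.1 s.2 s.2.isLt

variable [IsProbabilityMeasure P]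

theorem integral_sq_scoreTerm {S : Fin a → Matrix (Fin p) (Fin p) ℝ}
    (hLp : ∀ i j k, MemLp (fun ω => ε i j ω k) 4 P) (hmean : ∀ i j k, ∫ ω, ε i j ω k ∂P = 0)
    (hcov : ∀ i j k l, cov[fun ω => ε i j ω k, fun ω => ε i j ω l; P] = S i k l) (N : ℕ)
    (i : Fin a) (j : ℕ) (b : Fin p → ℝ) :
    ∫ ω, ((√(N : ℝ))⁻¹ * ∑ k, b k * ε i j ω k) ^ 2 ∂P = (N : ℝ)⁻¹ * (b ⬝ᵥ (S i *ᵥ b)) := by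
  simp only [mul_pow, inv_pow, Real.sq_sqrt (Nat.cast_nonneg N)]
  rw [integral_const_mul, integral_sq_linear_error hLp hmean hcov]

theorem posSemidef_scaledMiddle {S : Fin a → Matrix (Fin p) (Fin p) ℝ}
    (hS : ∀ i, (S i).PosSemidef) (N : ℕ) (n : Fin a → ℕ) (z : Fin a → ℕ → Fin c → ℝ) :
    (scaledMiddle N n z S).PosSemidef := by
  refine Matrix.PosSemidef.of_dotProduct_mulVec_nonneg ?_ fun t => ?_
  · rw [Matrix.IsHermitian, conjTranspose_eq_transpose_of_trivial]
    ext ⟨q, k⟩ ⟨q', l⟩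
    rw [Matrix.transpose_apply, scaledMiddle_apply, scaledMiddle_apply]
    refine Finset.sum_congr rfl fun i _ => ?_
    have h1 : S i l k = S i k l := by
      have := (hS i).isHermitian.apply l k
      simpa using this.symm
    have h2 : crossAverage n z i q' q = crossAverage n z i q q' := by
      simp only [crossAverage, mul_comm]
    rw [h1, h2]
  · rw [star_trivial, dotProduct_scaledMiddle_mulVec]
    refine Finset.sum_nonneg fun s _ => mul_nonneg (by positivity) ?_
    simpa using (hS s.1).dotProduct_mulVec_nonneg (scoreWeight z t s.1 s.2)

theorem posSemidef_of_tendsto {m : Type*} [Fintype m] {A : ℕ → Matrix m m ℝ} {B : Matrix m m ℝ}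
    (hA : ∀ N, (A N).PosSemidef) (h : Tendsto A atTop (𝓝 B)) : B.PosSemidef := by
  refine Matrix.PosSemidef.of_dotProduct_mulVec_nonneg ?_ fun t => ?_
  · rw [Matrix.IsHermitian, conjTranspose_eq_transpose_of_trivial]
    have h1 : Tendsto (fun N => (A N)ᵀ) atTop (𝓝 Bᵀ) :=
      (continuous_id.matrix_transpose.tendsto B).comp h
    refine tendsto_nhds_unique h1 (h.congr fun N => ?_)
    have := (hA N).isHermitian
    rwa [Matrix.IsHermitian, conjTranspose_eq_transpose_of_trivial, eq_comm] at this
  · have hc : Continuous fun D : Matrix m m ℝ => star t ⬝ᵥ (D *ᵥ t) := by fun_prop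
    exact ge_of_tendsto' ((hc.tendsto B).comp h) fun N => (hA N).dotProduct_mulVec_nonneg t

/-- The central limit theorem for the scaled score. -/
theorem tendstoInDistribution_scaledScore {S : Fin a → Matrix (Fin p) (Fin p) ℝ} {C₁ : ℝ}
    (hindep : iIndepFun (fun q : Fin a × ℕ => ε q.1 q.2) P)
    (hLp : ∀ i j k, MemLp (fun ω => ε i j ω k) 4 P) (hmean : ∀ i j k, ∫ ω, ε i j ω k ∂P = 0)
    (hcov : ∀ i j k l, cov[fun ω => ε i j ω k, fun ω => ε i j ω l; P] = S i k l)
    (hfourth : ∀ i j k, ∫ ω, ε i j ω k ^ 4 ∂P ≤ C₁) (hκ : ∀ i, 0 < κ i)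
    (hκlim : ∀ i, Tendsto (fun N : ℕ => (N : ℝ) / (n N i : ℝ)) atTop (𝓝 (κ i)))
    (hC : ∀ i q q', Tendsto (fun N => crossAverage (n N) z i q q') atTop (𝓝 (C i q q')))
    {V : Matrix ((Fin a ⊕ Fin c) × Fin p) ((Fin a ⊕ Fin c) × Fin p) ℝ} (hV : V.PosSemidef)
    (hVlim : Tendsto (fun N : ℕ => scaledMiddle N (n N) z S) atTop (𝓝 V)) :
    TendstoInDistribution (fun N ω => scaledScore N (n N) z fun i j => ε i j ω) atTop id
      (fun _ => P) (multivariateGaussian 0 V) where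
  forall_aemeasurable N := aemeasurable_scaledScore hLp N (n N) z
  aemeasurable_limit := aemeasurable_id
  tendsto := by
    have hmS := fun N => aemeasurable_scaledScore hLp N (n N) z
    refine ProbabilityMeasure.tendsto_iff_tendsto_charFun.mpr fun t => ?_
    simp only [ProbabilityMeasure.coe_mk, Measure.map_id]
    rw [charFun_multivariateGaussian hV]
    set X : ∀ N, Subj (n N) → Ω → ℝ := fun N s ω =>
      (√(N : ℝ))⁻¹ * ∑ k, scoreWeight z t s.1 s.2 k * ε s.1 s.2 ω k with hXdef
    obtain ⟨M, hM⟩ := exists_moment_bound hLp hfourth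
    set τ := ∑ q, t q ^ 2 with hτ
    have hτ0 : 0 ≤ τ := Finset.sum_nonneg fun _ _ => sq_nonneg _
    have hX4 : ∀ N s, MemLp (X N s) 4 P := fun N s =>
      (memLp_finsetSum _ fun k _ => (hLp s.1 s.2 k).const_mul _).const_mul _
    -- Cauchy-Schwarz bounds each squared weight, divided by `N`, by `τ` times the leverage; the
    -- randomness is left in a factor with uniformly bounded moments.
    have hXb : ∀ N s ω, |X N s ω| ≤ √(τ * leverage N z s.1 s.2) * ∑ k, |ε s.1 s.2 ω k| := by
      intro N s ω
      simp only [hXdef]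
      rw [Finset.mul_sum, Finset.mul_sum]
      refine (Finset.abs_sum_le_sum_abs _ _).trans (Finset.sum_le_sum fun k _ => ?_)
      rw [← mul_assoc, abs_mul]
      refine mul_le_mul_of_nonneg_right (Real.abs_le_sqrt ?_) (abs_nonneg _)
      rw [mul_pow, inv_pow, Real.sq_sqrt (Nat.cast_nonneg N), leverage, mul_left_comm]
      exact mul_le_mul_of_nonneg_left (sq_scoreWeight_le z t _ _ k) (by positivity)
    have hlev := tendsto_sum_leverage hκ hκlim hC
    have hlev0 : ∀ N (s : Subj (n N)), 0 ≤ leverage N z s.1 s.2 :=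
      fun N s => leverage_nonneg N z _ _
    have hsmall : ∀ δ > 0, ∀ᶠ N in atTop, ∀ s : Subj (n N), leverage N z s.1 s.2 ≤ δ :=
      fun δ hδ => eventually_leverage_le hκ hκlim hC hδ
    have hpowint : ∀ (i : Fin a) (j m : ℕ), m ≠ 0 → m ≤ 4 →
        Integrable (fun ω => (∑ k, |ε i j ω k|) ^ m) P := by
      intro i j m hm hm4
      have h1 : MemLp (fun ω => ∑ k, |ε i j ω k|) m P :=
        (hM i j).1.mono_exponent (by exact_mod_cast hm4)
      refine (h1.integrable_norm_pow hm).congr (ae_of_all _ fun ω => ?_)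
      simp only [Real.norm_eq_abs,
        abs_of_nonneg (Finset.sum_nonneg fun k _ => abs_nonneg (ε i j ω k))]
    have hmom : ∀ N (s : Subj (n N)) (m : ℕ), m ≠ 0 → m ≤ 4 →
        ∫ ω, (∑ k, |ε s.1 s.2 ω k|) ^ m ∂P ≤ M →
        ∫ ω, |X N s ω| ^ m ∂P ≤ √(τ * leverage N z s.1 s.2) ^ m * M := by
      intro N s m hm hm4 hmM
      have h1 : MemLp (X N s) m P := (hX4 N s).mono_exponent (by exact_mod_cast hm4)
      calc ∫ ω, |X N s ω| ^ m ∂P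
          ≤ ∫ ω, √(τ * leverage N z s.1 s.2) ^ m * (∑ k, |ε s.1 s.2 ω k|) ^ m ∂P := by
            refine integral_mono (by simpa using h1.integrable_norm_pow hm)
              ((hpowint _ _ m hm hm4).const_mul _) fun ω => ?_
            simp only
            rw [← mul_pow]
            exact pow_le_pow_left₀ (abs_nonneg _) (hXb N s ω) m
        _ = √(τ * leverage N z s.1 s.2) ^ m * ∫ ω, (∑ k, |ε s.1 s.2 ω k|) ^ m ∂P :=
            integral_const_mul _ _
        _ ≤ _ := mul_le_mul_of_nonneg_left hmM (by positivity)
    have hsq : ∀ N (s : Subj (n N)), ∫ ω, X N s ω ^ 2 ∂P ≤ τ * leverage N z s.1 s.2 * M := by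
      intro N s
      have := hmom N s 2 (by norm_num) (by norm_num) (hM s.1 s.2).2.1
      rw [Real.sq_sqrt (mul_nonneg hτ0 (hlev0 N s))] at this
      simpa only [sq_abs] using this
    have hvar : Tendsto (fun N => ∑ s, ∫ ω, X N s ω ^ 2 ∂P) atTop
        (𝓝 (t.ofLp ⬝ᵥ (V *ᵥ t.ofLp))) := by
      have hc : Continuous fun D : Matrix ((Fin a ⊕ Fin c) × Fin p) ((Fin a ⊕ Fin c) × Fin p) ℝ =>
        t.ofLp ⬝ᵥ (D *ᵥ t.ofLp) := by fun_prop
      refine ((hc.tendsto V).comp hVlim).congr fun N => ?_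
      rw [Function.comp_apply, dotProduct_scaledMiddle_mulVec]
      exact Finset.sum_congr rfl fun s _ => (integral_sq_scoreTerm hLp hmean hcov N _ _ _).symm
    -- Squared variances are of the order of the squared leverage, third absolute moments below of
    -- the order of its power `3/2`.
    have hvar2 : Tendsto (fun N => ∑ s, (∫ ω, X N s ω ^ 2 ∂P) ^ 2) atTop (𝓝 0) := by
      have h := (tendsto_sum_mul_comp hlev0 hlev hsmall (φ := id) continuousAt_id rfl).const_mul
        ((τ * M) ^ 2)
      rw [mul_zero] at h
      refine squeeze_zero (fun N => Finset.sum_nonneg fun s _ => sq_nonneg _) (fun N => ?_) h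
      rw [Finset.mul_sum]
      refine Finset.sum_le_sum fun s _ => ?_
      have h1 : 0 ≤ ∫ ω, X N s ω ^ 2 ∂P := integral_nonneg fun ω => sq_nonneg _
      refine (pow_le_pow_left₀ h1 (hsq N s) 2).trans (le_of_eq ?_)
      simp only [id]
      ring
    have h3 : Tendsto (fun N => ∑ s, ∫ ω, |X N s ω| ^ 3 ∂P) atTop (𝓝 0) := by
      have h := (tendsto_sum_mul_comp hlev0 hlev hsmall (φ := Real.sqrt)
        Real.continuous_sqrt.continuousAt Real.sqrt_zero).const_mul (τ * √τ * M)
      rw [mul_zero] at h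
      refine squeeze_zero (fun N => Finset.sum_nonneg fun s _ =>
        integral_nonneg fun ω => pow_nonneg (abs_nonneg _) _) (fun N => ?_) h
      rw [Finset.mul_sum]
      refine Finset.sum_le_sum fun s _ =>
        (hmom N s 3 (by norm_num) (by norm_num) (hM s.1 s.2).2.2).trans (le_of_eq ?_)
      rw [pow_succ, Real.sq_sqrt (mul_nonneg hτ0 (hlev0 N s)), Real.sqrt_mul hτ0]
      ring
    have hXindep : ∀ N, iIndepFun (X N) P := by
      intro N
      have hinj : Function.Injective fun s : Subj (n N) => ((s.1, (s.2 : ℕ)) : Fin a × ℕ) := by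
        rintro ⟨i, j⟩ ⟨i', j'⟩ h
        simp only [Prod.mk.injEq] at h
        obtain ⟨rfl, h⟩ := h
        rw [Fin.ext h]
      exact (hindep.precomp hinj).comp
        (fun s v => (√(N : ℝ))⁻¹ * ∑ k, scoreWeight z t s.1 s.2 k * v k) fun s => by fun_prop
    have hXmean : ∀ N s, ∫ ω, X N s ω ∂P = 0 := by
      intro N s
      rw [hXdef, integral_const_mul, integral_finsetSum _ fun k _ =>
        ((hLp s.1 s.2 k).integrable (by norm_num)).const_mul _]
      simp [integral_const_mul, hmean]
    have hmain := tendsto_integral_exp_sum_of_lyapunov X hXindep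
      (fun N s => (hX4 N s).mono_exponent (by norm_num)) hXmean hvar hvar2 h3
    have hexp : Complex.exp (((inner ℝ t (0 : EuclideanSpace ℝ ((Fin a ⊕ Fin c) × Fin p)) : ℝ) : ℂ)
        * Complex.I - ((t.ofLp ⬝ᵥ (V *ᵥ t.ofLp) : ℝ) : ℂ) / 2) =
        (Real.exp (-((t.ofLp ⬝ᵥ (V *ᵥ t.ofLp)) / 2)) : ℂ) := by
      rw [inner_zero_right]
      push_cast
      congr 1
      ring
    rw [hexp]
    refine hmain.congr fun N => ?_
    rw [charFun_apply, integral_map (hmS N) (by fun_prop)]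
    simp only [inner_scaledScore]
    rfl

end Score


/-! ### The limit of the nuisance quantities and the block `Λ₁₁`. -/

section Assembly

variable {a p c : ℕ} {Ω : Type*} [MeasurableSpace Ω] {P : Measure Ω}
  {ε : Fin a → ℕ → Ω → Fin p → ℝ} {n : ℕ → Fin a → ℕ} {z : Fin a → ℕ → Fin c → ℝ}
  {κ : Fin a → ℝ} {C : Fin a → Fin a ⊕ Fin c → Fin a ⊕ Fin c → ℝ}
  {Ξ : Matrix (Fin a ⊕ Fin c) (Fin a ⊕ Fin c) ℝ}

/-- The limit of the nuisance quantities. -/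
noncomputable def limitNuisance (κ : Fin a → ℝ) (C : Fin a → Fin a ⊕ Fin c → Fin a ⊕ Fin c → ℝ)
    (Ξ : Matrix (Fin a ⊕ Fin c) (Fin a ⊕ Fin c) ℝ) (S : Fin a → Matrix (Fin p) (Fin p) ℝ) :
    Nuisance a p c :=
  ((0, fun q q' => Ξ⁻¹ q q', κ, C), (fun q => S q.1 q.2 q.2, 0))

/-- The limit of `N^{-1/2}` is `0`, so every term coming from the estimation error vanishes,
whatever the score. -/
theorem scaledVariance_limitNuisance (S : Fin a → Matrix (Fin p) (Fin p) ℝ)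
    (v : EuclideanSpace ℝ ((Fin a ⊕ Fin c) × Fin p)) (q : Fin a × Fin p) :
    scaledVariance (v, limitNuisance κ C Ξ S) q = κ q.1 * S q.1 q.2 q.2 := by
  simp [scaledVariance, limitNuisance]

theorem aemeasurable_nuisance (hLp : ∀ i j k, MemLp (fun ω => ε i j ω k) 4 P) (N : ℕ)
    (n : Fin a → ℕ) (z : Fin a → ℕ → Fin c → ℝ) :
    AEMeasurable (fun ω => nuisance N n z fun i j => ε i j ω) P := by
  have h : ∀ i j k, AEMeasurable (fun ω => ε i j ω k) P :=
    fun i j k => (hLp i j k).aestronglyMeasurable.aemeasurable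
  refine aemeasurable_const.prodMk (AEMeasurable.prodMk ?_ ?_)
  · refine aemeasurable_pi_lambda _ fun q => AEMeasurable.const_mul ?_ _
    exact Finset.aemeasurable_fun_sum _ fun j _ => (h _ _ _).pow_const 2
  · refine aemeasurable_pi_lambda _ fun q => AEMeasurable.const_mul ?_ _
    exact Finset.aemeasurable_fun_sum _ fun j _ => (h _ _ _).const_mul _

theorem tendstoInMeasure_nuisance [IsProbabilityMeasure P] {S : Fin a → Matrix (Fin p) (Fin p) ℝ}
    {C₁ : ℝ} (hindep : iIndepFun (fun q : Fin a × ℕ => ε q.1 q.2) P)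
    (hLp : ∀ i j k, MemLp (fun ω => ε i j ω k) 4 P) (hmean : ∀ i j k, ∫ ω, ε i j ω k ∂P = 0)
    (hcov : ∀ i j k l, cov[fun ω => ε i j ω k, fun ω => ε i j ω l; P] = S i k l)
    (hfourth : ∀ i j k, ∫ ω, ε i j ω k ^ 4 ∂P ≤ C₁) (hκ : ∀ i, 0 < κ i)
    (hκlim : ∀ i, Tendsto (fun N : ℕ => (N : ℝ) / (n N i : ℝ)) atTop (𝓝 (κ i)))
    (hC : ∀ i q q', Tendsto (fun N => crossAverage (n N) z i q q') atTop (𝓝 (C i q q')))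
    (hΞ : Tendsto (fun N : ℕ => scaledGram N (n N) z) atTop (𝓝 Ξ)) (hdet : IsUnit Ξ.det) :
    TendstoInMeasure P (fun N ω => nuisance N (n N) z fun i j => ε i j ω) atTop
      fun _ => limitNuisance κ C Ξ S := by
  have hn := fun i => tendsto_groupSize (hκ i) (hκlim i)
  refine tendstoInMeasure_prodMk (tendstoInMeasure_of_tendsto ?_)
    (tendstoInMeasure_prodMk (tendstoInMeasure_pi fun q => ?_) (tendstoInMeasure_pi fun q => ?_))
  · refine Tendsto.prodMk_nhds ?_ (Tendsto.prodMk_nhds ?_ (Tendsto.prodMk_nhds ?_ ?_))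
    · exact tendsto_inv_atTop_zero.comp (Real.tendsto_sqrt_atTop.comp tendsto_natCast_atTop_atTop)
    · exact tendsto_inv_of_isUnit_det hΞ hdet
    · exact tendsto_pi_nhds.mpr fun i => tendsto_div_residualDegrees c (hκ i) (hκlim i)
    · exact tendsto_pi_nhds.mpr fun i => tendsto_pi_nhds.mpr fun q => tendsto_pi_nhds.mpr fun q' =>
        hC i q q'
  · exact tendstoInMeasure_errorSqAverage hindep hLp hmean hcov hfourth hn q
  · exact tendstoInMeasure_errorFeatureAverage hindep hLp hmean hcov hn hC q

theorem TendstoInDistribution.of_map_eq {E Ω₁ Ω₂ : Type*} [TopologicalSpace E] [MeasurableSpace E]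
    [OpensMeasurableSpace E] [MeasurableSpace Ω₁] [MeasurableSpace Ω₂] [IsProbabilityMeasure P]
    {P₁ : Measure Ω₁} [IsProbabilityMeasure P₁] {P₂ : Measure Ω₂} [IsProbabilityMeasure P₂]
    {X : ℕ → Ω → E} {Z₁ : Ω₁ → E} {Z₂ : Ω₂ → E}
    (h : TendstoInDistribution X atTop Z₁ (fun _ => P) P₁) (hZ : AEMeasurable Z₂ P₂)
    (heq : P₁.map Z₁ = P₂.map Z₂) : TendstoInDistribution X atTop Z₂ (fun _ => P) P₂ where
  forall_aemeasurable := h.forall_aemeasurable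
  aemeasurable_limit := hZ
  tendsto := by
    have := h.tendsto
    simp only [heq] at this
    exact this

/-- Symmetry of `K` makes the right factor the transpose of the left one, so the block is the
covariance of a linear image of `N(0, V)`. -/
theorem upperLeft_sandwich {K : Matrix (Fin a ⊕ Fin c) (Fin a ⊕ Fin c) ℝ} (hK : Kᵀ = K)
    (V : Matrix ((Fin a ⊕ Fin c) × Fin p) ((Fin a ⊕ Fin c) × Fin p) ℝ) :
    upperLeft ((K ⊗ₖ (1 : Matrix (Fin p) (Fin p) ℝ)) * V * (K ⊗ₖ (1 : Matrix (Fin p) (Fin p) ℝ))) =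
      (K ⊗ₖ (1 : Matrix (Fin p) (Fin p) ℝ)).submatrix
          (fun q : Fin a × Fin p => (Sum.inl q.1, q.2)) id * V *
        ((K ⊗ₖ (1 : Matrix (Fin p) (Fin p) ℝ)).submatrix
          (fun q : Fin a × Fin p => (Sum.inl q.1, q.2)) id)ᵀ := by
  have hKt : (K ⊗ₖ (1 : Matrix (Fin p) (Fin p) ℝ))ᵀ = K ⊗ₖ (1 : Matrix (Fin p) (Fin p) ℝ) := by
    rw [← Matrix.kroneckerMap_transpose, hK, Matrix.transpose_one]
  rw [Matrix.transpose_submatrix, hKt]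
  rfl

theorem kronVec_inl (K : Matrix (Fin a ⊕ Fin c) (Fin a ⊕ Fin c) ℝ)
    (v : (Fin a ⊕ Fin c) × Fin p → ℝ) :
    (fun q : Fin a × Fin p => kronVec K v (Sum.inl q.1, q.2)) =
      (K ⊗ₖ (1 : Matrix (Fin p) (Fin p) ℝ)).submatrix
        (fun q : Fin a × Fin p => (Sum.inl q.1, q.2)) id *ᵥ v := by
  funext q
  simp only [kronVec, Matrix.mulVec, dotProduct, Fintype.sum_prod_type, Matrix.submatrix_apply,
    Matrix.kronecker_apply, Matrix.one_apply, id, mul_ite, mul_one, mul_zero, ite_mul, zero_mul,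
    Finset.sum_ite_eq, Finset.mem_univ, if_true]

theorem transpose_eq_of_tendsto_scaledGram
    (hΞ : Tendsto (fun N : ℕ => scaledGram N (n N) z) atTop (𝓝 Ξ)) : Ξᵀ = Ξ := by
  have h1 : Tendsto (fun N => (scaledGram N (n N) z)ᵀ) atTop (𝓝 Ξᵀ) :=
    (continuous_id.matrix_transpose.tendsto Ξ).comp hΞ
  refine tendsto_nhds_unique h1 (hΞ.congr fun N => ?_)
  simp [scaledGram]

end Assembly

end Mancova

/-! ### The main theorem. -/

theorem theorem2 {a p c : ℕ} {r : Type*} [Fintype r]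
    -- group sizes when the total sample size is `N`
    (n : ℕ → Fin a → ℕ) (hn : ∀ N, ∑ i, n N i = N)
    -- fixed covariates, parameters, errors, outcomes and the model equation
    (z : Fin a → ℕ → Fin c → ℝ) (μ : Fin a × Fin p → ℝ) (ν : Fin c × Fin p → ℝ)
    {Ω : Type*} [MeasurableSpace Ω] (P : Measure Ω) [IsProbabilityMeasure P]
    (ε Y : Fin a → ℕ → Ω → Fin p → ℝ)
    (hY : ∀ i j ω k, Y i j ω k = μ (i, k) + ∑ w, z i j w * ν (w, k) + ε i j ω k)
    (S : Fin a → Matrix (Fin p) (Fin p) ℝ) (C₁ : ℝ)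
    -- (M1)
    (hindep : iIndepFun (fun q : Fin a × ℕ => ε q.1 q.2) P)
    (hLp : ∀ i j k, MemLp (fun ω => ε i j ω k) 4 P)
    (hmean : ∀ i j k, ∫ ω, ε i j ω k ∂P = 0)
    (hcov : ∀ i j k l, cov[fun ω => ε i j ω k, fun ω => ε i j ω l; P] = S i k l)
    (hfourth : ∀ i j k, ∫ ω, ε i j ω k ^ 4 ∂P ≤ C₁)
    -- (M2)*
    (hpsd : ∀ i, (S i).PosSemidef) (hvar : ∀ i k, 0 < S i k k)
    -- (M3)
    (κ : Fin a → ℝ) (hκ : ∀ i, 0 < κ i)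
    (hκlim : ∀ i, Tendsto (fun N : ℕ => (N : ℝ) / (n N i : ℝ)) atTop (𝓝 (κ i)))
    -- (M4), for all large samples and in the limit
    (hrank : ∀ᶠ N in atTop, LinearIndependent ℝ (Mancova.designMatrix (n N) z).col)
    (hlimrank : ∀ Ξ : Matrix (Fin a ⊕ Fin c) (Fin a ⊕ Fin c) ℝ,
      Tendsto (fun N : ℕ => Mancova.scaledGram N (n N) z) atTop (𝓝 Ξ) → IsUnit Ξ.det)
    -- (M5)
    (cbar : Fin a → Fin c → ℝ)
    (hcbar : ∀ i w, Tendsto (fun N : ℕ => 1 / (n N i : ℝ) * ∑ j : Fin (n N i), z i j w)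
      atTop (𝓝 (cbar i w)))
    -- (M6)
    (Ξg : Fin a → Matrix (Fin c) (Fin c) ℝ)
    (hΞg : ∀ i, Tendsto
      (fun N : ℕ => (1 / (n N i : ℝ)) • ∑ j : Fin (n N i), vecMulVec (z i j) (z i j))
      atTop (𝓝 (Ξg i)))
    -- hypothesis matrix and null hypothesis
    (H : Matrix r (Fin a × Fin p) ℝ) (T : Matrix (Fin a × Fin p) (Fin a × Fin p) ℝ)
    (hT : T = Mancova.hypothesisProjector H) (hH₀ : T *ᵥ μ = 0) :
    ∃ (Ξ : Matrix (Fin a ⊕ Fin c) (Fin a ⊕ Fin c) ℝ)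
      (Ψ L : Matrix ((Fin a ⊕ Fin c) × Fin p) ((Fin a ⊕ Fin c) × Fin p) ℝ),
      Tendsto (fun N : ℕ => Mancova.scaledGram N (n N) z) atTop (𝓝 Ξ) ∧
      Tendsto (fun N : ℕ => Mancova.scaledMiddle N (n N) z S) atTop (𝓝 Ψ) ∧
      L = (Ξ⁻¹ ⊗ₖ (1 : Matrix (Fin p) (Fin p) ℝ)) * Ψ *
        (Ξ⁻¹ ⊗ₖ (1 : Matrix (Fin p) (Fin p) ℝ)) ∧
      Tendsto (fun N : ℕ => (Mancova.bigScaledGram p N (n N) z)⁻¹ *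
          Mancova.scaledMiddle N (n N) z S * (Mancova.bigScaledGram p N (n N) z)⁻¹)
        atTop (𝓝 L) ∧
      ∃ lam : Fin a × Fin p → ℝ,
        -- `lam` lists the eigenvalues of `T (T D T)⁺ T Λ₁₁` with multiplicity
        (T * Mancova.pinv (T * Mancova.limitD κ S * T) * T * Mancova.upperLeft L).charpoly
          = ∏ q, (Polynomial.X - Polynomial.C (lam q)) ∧
        ∀ {Ω' : Type*} [MeasurableSpace Ω'] (P' : Measure Ω') [IsProbabilityMeasure P']
          (U : Fin a × Fin p → Ω' → ℝ),
          iIndepFun U P' → (∀ q, HasLaw (U q) Mancova.chiSqOne P') →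
          TendstoInDistribution
            (fun (N : ℕ) ω => Mancova.mancats (n N) z T (fun i j => Y i j ω)) atTop
            (fun ω' => ∑ q, lam q * U q ω') (fun _ => P) P' := by
  classical
  obtain ⟨C, hC⟩ := Mancova.exists_tendsto_crossAverage hκ hκlim hcbar hΞg
  have hΞ := Mancova.tendsto_scaledGram hκ hκlim hC
  have hΨ := Mancova.tendsto_scaledMiddle hκ hκlim hC S
  set Ξ : Matrix (Fin a ⊕ Fin c) (Fin a ⊕ Fin c) ℝ :=
    Matrix.of fun q q' => ∑ i, (κ i)⁻¹ * C i q q' with hΞdef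
  set Ψ : Matrix ((Fin a ⊕ Fin c) × Fin p) ((Fin a ⊕ Fin c) × Fin p) ℝ :=
    Matrix.of fun q q' => ∑ i, (κ i)⁻¹ * C i q.1 q'.1 * S i q.2 q'.2 with hΨdef
  have hdet : IsUnit Ξ.det := hlimrank Ξ hΞ
  refine ⟨Ξ, Ψ, _, hΞ, hΨ, rfl, Mancova.tendsto_sandwich hΞ hdet hΨ, ?_⟩
  have hTs : Tᵀ = T := by rw [hT, Mancova.hypothesisProjector_transpose]
  have hTT : T * T = T := by rw [hT, Mancova.hypothesisProjector_mul_self]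
  have hΞs : (Ξ⁻¹)ᵀ = Ξ⁻¹ := by
    rw [Matrix.transpose_nonsing_inv, Mancova.transpose_eq_of_tendsto_scaledGram hΞ]
  have hΨpsd : Ψ.PosSemidef := Mancova.posSemidef_of_tendsto
    (fun N => Mancova.posSemidef_scaledMiddle hpsd N (n N) z) hΨ
  set K := (Ξ⁻¹ ⊗ₖ (1 : Matrix (Fin p) (Fin p) ℝ)).submatrix
    (fun q : Fin a × Fin p => (Sum.inl q.1, q.2)) id with hK
  have hL := Mancova.upperLeft_sandwich hΞs Ψ
  rw [← hK] at hL
  have hLpsd : (K * Ψ * Kᵀ).PosSemidef := by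
    simpa using hΨpsd.mul_mul_conjTranspose_same K
  set W := T * Mancova.pinv (T * Mancova.limitD κ S * T) * T with hW
  have hWs : Wᵀ = W := by
    have hD : (Mancova.limitD κ S)ᵀ = Mancova.limitD κ S := Matrix.diagonal_transpose _
    simp only [hW, transpose_mul, ← Mancova.pinv_transpose, hTs, hD, Matrix.mul_assoc]
  obtain ⟨A, lam, hA, hAW, hchar⟩ := Mancova.exists_simultaneous_diagonalization hWs hLpsd
  refine ⟨lam, by rw [hL]; exact hchar, ?_⟩
  intro Ω' _ P' _ U hU hlaw
  have hYε : ∀ ω, (fun i j => Y i j ω) = Mancova.modelOutcome z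
      (fun q => Sum.elim (fun i => μ (i, q.2)) (fun w => ν (w, q.2)) q.1) (fun i j => ε i j ω) := by
    intro ω
    funext i j k
    simp [hY, Mancova.modelOutcome, Mancova.feature, Fintype.sum_sum_type]
  have hA_meas : ∀ N, AEMeasurable
      (fun ω => Mancova.mancats (n N) z T (fun i j => Y i j ω)) P := by
    intro N
    refine (Mancova.measurable_mancats (n N) z T).comp_aemeasurable ?_
    refine aemeasurable_pi_lambda _ fun i => aemeasurable_pi_lambda _ fun j =>
      aemeasurable_pi_lambda _ fun k => ?_
    simp only [hY]
    exact (hLp i j k).aestronglyMeasurable.aemeasurable.const_add _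
  have hscore := Mancova.tendstoInDistribution_scaledScore hindep hLp hmean hcov hfourth hκ hκlim hC
    hΨpsd hΨ
  have hjoint := hscore.prodMk_of_tendstoInMeasure_const _ _ _
    (Mancova.tendstoInMeasure_nuisance hindep hLp hmean hcov hfourth hκ hκlim hC hΞ hdet)
    fun N => Mancova.aemeasurable_nuisance hLp N (n N) z
  -- Continuity holds at every limit point: the limiting scaled variances are the constants `κᵢ
  -- σ²_{ik} > 0`.
  have hmain := Mancova.tendstoInDistribution_comp_of_ae_continuousAt hjoint
    (Mancova.measurable_studentizedForm T)
    (ae_of_all _ fun v => Mancova.continuousAt_studentizedForm hTs hTT fun q => by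
      rw [Mancova.scaledVariance_limitNuisance]
      exact mul_pos (hκ _) (hvar _ _)) hA_meas (by
      filter_upwards [eventually_ne_atTop 0, Mancova.eventually_isUnit_det hΞ hdet] with N hN hNdet ω
      rw [hYε ω]
      exact Mancova.mancats_modelOutcome hN hNdet hH₀ _)
  refine Mancova.TendstoInDistribution.of_map_eq hmain ?_ ?_
  · exact Finset.aemeasurable_fun_sum _ fun q _ => (hlaw q).aemeasurable.const_mul _
  -- The law of the weighted `χ²₁` sum is that of the form `W` under `N(0, KΨKᵀ)`, which is in turn
  -- the image of `N(0, Ψ)` under `K`.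
  · rw [← Mancova.map_quadraticForm_multivariateGaussian hA hAW hU hlaw,
      ← Mancova.map_mulVec_multivariateGaussian hΨpsd K, Measure.map_map]
    · congr 1
      funext v
      have hD : diagonal (Mancova.scaledVariance (v, Mancova.limitNuisance κ C Ξ S)) =
          Mancova.limitD κ S := by
        rw [Mancova.limitD]
        congr 1
        funext q
        exact Mancova.scaledVariance_limitNuisance S v q
      have hv := Mancova.kronVec_inl Ξ⁻¹ v.ofLp
      rw [← hK] at hv
      change Mancova.studentizedForm T (v, Mancova.limitNuisance κ C Ξ S) = _
      rw [Mancova.studentizedForm, hD, hTs]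
      change (fun q : Fin a × Fin p => Mancova.kronVec Ξ⁻¹ v.ofLp (Sum.inl q.1, q.2)) ⬝ᵥ
        (W *ᵥ fun q : Fin a × Fin p => Mancova.kronVec Ξ⁻¹ v.ofLp (Sum.inl q.1, q.2)) = _
      rw [hv]
      rfl
    · have : Continuous fun x : EuclideanSpace ℝ (Fin a × Fin p) => x ⬝ᵥ W *ᵥ x := by fun_prop
      exact this.measurable
    · have : Continuous fun x : EuclideanSpace ℝ ((Fin a ⊕ Fin c) × Fin p) =>
          (WithLp.toLp 2 (K *ᵥ x) : EuclideanSpace ℝ (Fin a × Fin p)) := by fun_prop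
      exact this.measurable
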